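/- Let $t\ge 1$, let $k$ be a field with algebraic closure $K$, and let $d=(d_1,\dots,d_t)$ be a vector of positive integers that is concave, i.e. $d_1\ge d_2\ge\dots\ge d_a\le d_{a+1}\le\dots\le d_t$ for some $a$. Notation. Put $r_{i,j}=\min\{d_l : i\le l\le j\}$ and let $\mathcal R(Q,d)$ be the affine space, with its Zariski topology, of all tuples $A=(A_{i,i+1})_{1\le i<t}$ of linear maps $A_{i,i+1}:K^{d_{i+1}}\to K^{d_i}$, that is, of representations of dimension vector $d$ of the linearly oriented quiver of type $\mathbb A_t$. For $i<j$ put $A_{(i,j)}=A_{i,i+1}A_{i+1,i+2}\cdots A_{j-1,j}$. Let $Y$ be the complement in $\mathcal R(Q,d)$ of the generic orbit $\{A : \operatorname{rk}A_{(i,j)}=r_{i,j}\text{ for all }1\le i<j\le t\}$, and for $1\le i<j\le t$ let $Y_{i,j}=\{A\in\mathcal R(Q,d) : \operatorname{rk}A_{(i,j)}\le r_{i,j}-1\}$. Let $J(d)$ be the set of pairs $(i,j)$ with $1\le i<j\le t$ and $d_l>\max\{d_i,d_j\}$ for all $i<l<j$. Set $d_0=d_{t+1}=0$ and let $I(d)$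 be the set of those $(i,j)\in J(d)$ for which one of the following holds: (i) $d_i=d_j$; (ii) $d_i<d_j$, and if $a$ is the minimal index $a>j$ with $d_a<d_i$, then $d_l\ge d_j$ for all $j<l<a$; (iii) $d_i>d_j$, and if $b$ is the maximal index $b<i$ with $d_b<d_j$, then $d_l\ge d_i$ for all $b<l<i$. For $1\le i\le j\le t$ let $[i,j]$ be the indecomposable representation with the space $K$ at the vertices $i,\dots,j$, identity maps between them, and zero elsewhere. Each representation is isomorphic to $\bigoplus[i,j]^{a_{i,j}}$ for a unique multisegment $(a_{i,j})$. Let $M(d)$ be the multisegment of the representations in the dense orbit of $\prod_i \mathrm{GL}(d_i)$ in $\mathcal R(Q,d)$; $d$ is called generic if $M(d)$ contains precisely $t$ pairwise different segments. Then: a) $I(d)=J(d)=\{(1,2),(2,3),\dots,(t-1,t)\}$. b) $Y$ has precisely $t-1$ irreducible components, namely the pairwise different varieties $Y_{i,i+1}$ for $i=1,\dots,t-1$, and $Y_{i,i+1}$ has codimension $|d_i-d_{i+1}|+1$ in $\mathcal R(Q,d)$. c) For $1\le i<j\le t$, the variety $Y_{i,j}$ is irreducible if and only if $j=i+1$. d)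 $d$ is generic if and only if for all $i<j$ with $d_i=d_j$ there exists some $l$ with $i<l<j$ and $d_l<d_i=d_j$. e) $(i,i+1)\mapsto Y_{i,i+1}$ is a bijection from the pairs $(i,i+1)$ with $d_i=d_{i+1}$ onto the irreducible components of $Y$ of codimension one. -/

import Mathlib

/-! The vertices `1, …, t` of the linearly oriented quiver of type `A_t` are modelled by `Fin (n + 1)`,
so `t = n + 1` and the vertex `p` is the element of value `p - 1`.  The arrows are indexed by `Fin n`:
the arrow `i` goes from the vertex `i.succ` to the vertex `i.castSucc`. -/

noncomputable section

namespace TypeA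

variable {n : ℕ}

/-! ### Combinatorics of dimension vectors -/

/-- Concave dimension vectors: `d_1 ≥ ⋯ ≥ d_a ≤ ⋯ ≤ d_t` for some `a`. -/
def IsConcave (d : Fin (n + 1) → ℕ) : Prop :=
  ∃ a, AntitoneOn d (Set.Iic a) ∧ MonotoneOn d (Set.Ici a)

/-- `r_{i,j} = min {d_l | i ≤ l ≤ j}`. -/
def minDim (d : Fin (n + 1) → ℕ) (i j : Fin (n + 1)) (h : i ≤ j) : ℕ :=
  (Finset.Icc i j).inf' ⟨i, Finset.left_mem_Icc.2 h⟩ d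

/-- The dimension vector with its entries indexed from `1` to `t = n + 1`, and extended by
`d_0 = d_{t+1} = 0`. -/
def extDim (d : Fin (n + 1) → ℕ) : ℕ → ℕ
  | 0 => 0
  | p + 1 => if h : p < n + 1 then d ⟨p, h⟩ else 0

/-- The set `J(d)` of pairs `i < j` such that `d_l > max (d_i, d_j)` for all `i < l < j`. -/
def J (d : Fin (n + 1) → ℕ) : Set (Fin (n + 1) × Fin (n + 1)) :=
  {p | p.1 < p.2 ∧ ∀ l, p.1 < l → l < p.2 → max (d p.1) (d p.2) < d l}

/-- The condition on `(i, j)` with `d_i < d_j`: if `a` is the minimal index `a > j` with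
`d_a < d_i`, then `d_l ≥ d_j` for all `j < l < a`.  The index `a` ranges over `1, …, t + 1`,
and `j` has index `j.val + 1`. -/
def RightCond (d : Fin (n + 1) → ℕ) (i j : Fin (n + 1)) : Prop :=
  ∃ a : ℕ, IsLeast {a | (j : ℕ) + 1 < a ∧ extDim d a < d i} a ∧
    ∀ l : ℕ, (j : ℕ) + 1 < l → l < a → d j ≤ extDim d l

/-- The condition on `(i, j)` with `d_i > d_j`: if `b` is the maximal index `b < i` with
`d_b < d_j`, then `d_l ≥ d_i` for all `b < l < i`.  The index `b` ranges over `0, …, t`,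
and `i` has index `i.val + 1`. -/
def LeftCond (d : Fin (n + 1) → ℕ) (i j : Fin (n + 1)) : Prop :=
  ∃ b : ℕ, IsGreatest {b | b < (i : ℕ) + 1 ∧ extDim d b < d j} b ∧
    ∀ l : ℕ, b < l → l < (i : ℕ) + 1 → d i ≤ extDim d l

/-- The set `I(d)`. -/
def I (d : Fin (n + 1) → ℕ) : Set (Fin (n + 1) × Fin (n + 1)) :=
  {p | p ∈ J d ∧
    (d p.1 = d p.2 ∨
      (d p.1 < d p.2 ∧ RightCond d p.1 p.2) ∨
      (d p.2 < d p.1 ∧ LeftCond d p.1 p.2))}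

/-! ### The representation space and its Zariski topology -/

variable (K : Type*) [Field K]

/-- The representation space `R(Q, d)`: a representation is a family of matrices
`A_{i,i+1} : K^{d_{i+1}} → K^{d_i}`. -/
def Rep (d : Fin (n + 1) → ℕ) : Type _ :=
  ∀ i : Fin n, Matrix (Fin (d i.castSucc)) (Fin (d i.succ)) K

/-- The matrix entries, the coordinates of the affine space `R(Q, d)`. -/
abbrev Coord (d : Fin (n + 1) → ℕ) : Type :=
  Σ i : Fin n, Fin (d i.castSucc) × Fin (d i.succ)

variable {K} {d : Fin (n + 1) → ℕ}

/-- The point of affine space given by the matrix entries of a representation. -/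
def Rep.toPoint (A : Rep K d) : Coord d → K := fun c => A c.1 c.2.1 c.2.2

/-- The Zariski topology on the affine space `R(Q, d)`; see `Rep.isClosed_iff`. -/
instance Rep.zariski : TopologicalSpace (Rep K d) :=
  TopologicalSpace.induced
    (fun A => (MvPolynomial.pointToPoint A.toPoint : PrimeSpectrum (MvPolynomial (Coord d) K)))
    inferInstance

/-- The closed subsets of `R(Q, d)` are the common zero sets of families of polynomials in the
matrix entries. -/
theorem Rep.isClosed_iff (S : Set (Rep K d)) :
    IsClosed S ↔ ∃ P : Set (MvPolynomial (Coord d) K),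
      S = {A | ∀ f ∈ P, MvPolynomial.eval A.toPoint f = 0} := by
  have key : ∀ P : Set (MvPolynomial (Coord d) K),
      (fun A : Rep K d => (MvPolynomial.pointToPoint A.toPoint :
        PrimeSpectrum (MvPolynomial (Coord d) K))) ⁻¹' PrimeSpectrum.zeroLocus P
        = {A | ∀ f ∈ P, MvPolynomial.eval A.toPoint f = 0} := by
    intro P
    ext A
    simp only [Set.mem_preimage, PrimeSpectrum.mem_zeroLocus, Set.mem_ofPred_eq, Set.subset_def,
      MvPolynomial.pointToPoint, SetLike.mem_coe, MvPolynomial.mem_vanishingIdeal_singleton_iff]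
    rfl
  rw [isClosed_induced_iff]
  constructor
  · rintro ⟨T, hT, rfl⟩
    obtain ⟨P, rfl⟩ := (PrimeSpectrum.isClosed_iff_zeroLocus _).1 hT
    exact ⟨P, key P⟩
  · rintro ⟨P, rfl⟩
    exact ⟨_, PrimeSpectrum.isClosed_zeroLocus P, key P⟩

/-- The set of irreducible components of a subspace `Y` of a topological space, as subsets of
the ambient space. -/
def components {X : Type*} [TopologicalSpace X] (Y : Set X) : Set (Set X) :=
  (fun Z : Set Y => Subtype.val '' Z) '' irreducibleComponents Y

/-- The codimension of a subset `Z` of a topological space: for irreducible closed `Z`, the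
supremum of the lengths of chains `Z = Z_0 ⊂ Z_1 ⊂ ⋯ ⊂ Z_c` of irreducible closed subsets; in general the
infimum of the codimensions of the irreducible closed subsets of `Z`. -/
def codim {X : Type*} [TopologicalSpace X] (Z : Set X) : ℕ∞ :=
  ⨅ (S : TopologicalSpace.IrreducibleCloseds X) (_ : (S : Set X) ⊆ Z), Order.coheight S

/-- On irreducible closed subsets the codimension is given by chains starting there. -/
theorem codim_irreducibleCloseds {X : Type*} [TopologicalSpace X]
    (S : TopologicalSpace.IrreducibleCloseds X) : codim (S : Set X) = Order.coheight S :=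
  le_antisymm (iInf₂_le S (Set.Subset.refl _))
    (le_iInf₂ fun _ hT => Order.coheight_anti (SetLike.coe_subset_coe.1 hT))

/-! ### Rank conditions -/

/-- The matrix of `A` that starts at the vertex of value `p + 1` and ends at that of value `p`. -/
def Rep.mat (A : Rep K d) (p : ℕ) (h : p + 1 < n + 1) :
    Matrix (Fin (d ⟨p, by omega⟩)) (Fin (d ⟨p + 1, h⟩)) K :=
  A ⟨p, by omega⟩

/-- The product `A_{i,i+1} A_{i+1,i+2} ⋯ A_{i+m-1,i+m}`. -/
def Rep.comp (A : Rep K d) (i : Fin (n + 1)) :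
    (m : ℕ) → (h : (i : ℕ) + m < n + 1) → Matrix (Fin (d i)) (Fin (d ⟨i + m, h⟩)) K
  | 0, _ => (1 : Matrix (Fin (d i)) (Fin (d i)) K)
  | m + 1, h => Rep.comp A i m _ * A.mat (i + m) h

/-- The rank of `A_{(i,j)} = A_{i,i+1} ⋯ A_{j-1,j}`. -/
def Rep.rk (A : Rep K d) (i j : Fin (n + 1)) (h : i ≤ j) : ℕ :=
  (A.comp i (j - i) (by have := Fin.le_def.1 h; omega)).rank

variable (K d)

/-- The generic orbit `O(d)`. -/
def genericOrbit : Set (Rep K d) :=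
  {A | ∀ i j (h : i < j), A.rk i j h.le = minDim d i j h.le}

/-- The complement `Y` of the generic orbit. -/
def Y : Set (Rep K d) := (genericOrbit K d)ᶜ

/-- The variety `Y_{i,j}`, given by the rank condition `rk A_{(i,j)} ≤ r_{i,j} - 1`. -/
def Yij (i j : Fin (n + 1)) (h : i < j) : Set (Rep K d) :=
  {A | A.rk i j h.le < minDim d i j h.le}

/-! ### Multisegments and generic dimension vectors -/

/-- A multisegment `⊕ [i,j]^{a_{i,j}}`, given by the multiplicity `a_{i,j}` of each segment
`[i,j]`, `i ≤ j`. -/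
abbrev Multisegment (n : ℕ) : Type := NonemptyInterval (Fin (n + 1)) → ℕ

/-- The standard basis, at the vertex `l`, of the representation belonging to a multisegment `M`:
one vector for each of the `M s` copies of each segment `s` that contains `l`. -/
abbrev Multisegment.Idx (M : Multisegment n) (l : Fin (n + 1)) : Type :=
  {p : Σ s : NonemptyInterval (Fin (n + 1)), Fin (M s) // l ∈ p.1}

variable {K d}

open Classical in
/-- The representation `A` is isomorphic to the representation `⊕ [i,j]^{M [i,j]}`: the spaces
`K^{d_l}` have bases indexed by the copies of segments of `M` through `l`, in which each map of `A`
sends the basis vector of a copy of a segment to the basis vector of the same copy, or to zero if the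
segment does not contain the target vertex. -/
def Rep.IsoTo (A : Rep K d) (M : Multisegment n) : Prop :=
  ∃ b : ∀ l : Fin (n + 1), Module.Basis (M.Idx l) K (Fin (d l) → K),
    ∀ (i : Fin n) (p : M.Idx i.succ),
      Matrix.mulVec (A i) (b i.succ p) =
        if h : i.castSucc ∈ p.1.1 then b i.castSucc ⟨p.1, h⟩ else 0

variable (K d)

/-- `d` is generic: the multisegment `M(d)` whose orbit is dense in `R(Q, d)` contains precisely
`t = n + 1` pairwise different segments. -/
def IsGeneric : Prop :=
  ∃ M : Multisegment n, Dense {A : Rep K d | A.IsoTo M} ∧ {s | M s ≠ 0}.ncard = n + 1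

end TypeA

end

/-! The entries of a concave vector fall weakly down to a vertex `a` and rise weakly after it. If
every single map has maximal rank, the maps into vertices left of `a` are injective and the others
surjective, so every composition has maximal rank too (`Rep.rank_comp`). Hence `Y` is the union of
the loci `Y_{i,i+1}` where one map drops rank (`Y_eq_iUnion`), and each of these constrains a single
matrix.

After a transposition if necessary, such a locus consists of the `m × (q + 1)` matrices, `q < m`,
with a nontrivial kernel (`kerLocus`). It is closed by maximal minors, and irreducible as the
polynomial image of an affine space of factorizations through dimension `q`. Its codimension is `m -
q`: imposing the kernel on one more row at a time gives a chain of that length, and Krull's height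
theorem, applied to the minors bordering a nonzero `q`-minor, gives the upper bound. Representations
with a single nonzero map (`Rep.single`) show that no locus contains another, and that `Y_{i,j}`
with `j > i + 1` lies in none of the loci covering it.

On the generic orbit, which is open and dense, adapted bases can be built outward from `a`. Only
segments that cannot be prolonged away from `a` occur; there are `t` of these, with multiplicities
`d_a` and `|d_i - d_{i+1}|`. So `d` is generic exactly when neighbouring entries differ, which for
concave `d` is the condition in d). -/

namespace TypeA

open MvPolynomial

/-! ### Irreducibility, vanishing ideals and codimension in the Zariski topology -/

section Zariski

variable {n : ℕ} {K : Type*} {d : Fin (n + 1) → ℕ}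

/-- The representation with given matrix entries. -/
def Rep.ofPoint (x : Coord d → K) : Rep K d := fun i => Matrix.of fun a b => x ⟨i, a, b⟩

@[simp] theorem Rep.toPoint_ofPoint (x : Coord d → K) : (Rep.ofPoint x).toPoint = x := rfl

@[simp] theorem Rep.ofPoint_toPoint (A : Rep K d) : Rep.ofPoint A.toPoint = A := rfl

variable [Field K]

theorem Rep.isClosed_zeros (P : Set (MvPolynomial (Coord d) K)) :
    IsClosed {A : Rep K d | ∀ f ∈ P, eval A.toPoint f = 0} :=
  (Rep.isClosed_iff _).2 ⟨P, rfl⟩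

/-- The image of an affine space under a polynomial map is irreducible. -/
theorem Rep.isIrreducible_range [Infinite K] {τ : Type*} (P : Coord d → MvPolynomial τ K) :
    IsIrreducible (Set.range fun y : τ → K => (Rep.ofPoint fun c => eval y (P c) : Rep K d)) := by
  refine ⟨Set.range_nonempty _, isPreirreducible_iff_isClosed_union_isClosed.2 ?_⟩
  intro C₁ C₂ h₁ h₂ h
  obtain ⟨P₁, rfl⟩ := (Rep.isClosed_iff _).1 h₁
  obtain ⟨P₂, rfl⟩ := (Rep.isClosed_iff _).1 h₂
  by_contra! hc
  obtain ⟨⟨_, ⟨y, rfl⟩, hy⟩, ⟨_, ⟨z, rfl⟩, hz⟩⟩ := hc.imp Set.not_subset.1 Set.not_subset.1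
  simp only [Set.mem_ofPred_eq, not_forall, Rep.toPoint_ofPoint] at hy hz
  obtain ⟨f, hf, hfy⟩ := hy
  obtain ⟨g, hg, hgz⟩ := hz
  -- Pulling back along the map sends `f` and `g` to polynomials with zero product, and the
  -- polynomial ring over an infinite field has no zero divisors and no nonzero polynomial vanishing
  -- everywhere.
  have key (y : τ → K) (f : MvPolynomial (Coord d) K) :
      eval (fun c => eval y (P c)) f = eval y (bind₁ P f) := by
    simp only [← coe_aeval_eq_eval, RingHom.coe_coe, aeval_bind₁]
  have hz : bind₁ P f * bind₁ P g = 0 := by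
    refine MvPolynomial.funext fun y => ?_
    rw [map_mul, map_zero, ← key, ← key]
    rcases h ⟨y, rfl⟩ with h | h
    · rw [show eval (fun c => eval y (P c)) f = 0 from h f hf, zero_mul]
    · rw [show eval (fun c => eval y (P c)) g = 0 from h g hg, mul_zero]
  rcases mul_eq_zero.1 hz with h | h
  · exact hfy (by rw [key, h, map_zero])
  · exact hgz (by rw [key, h, map_zero])

instance [Infinite K] : IrreducibleSpace (Rep K d) := by
  have : IsIrreducible (Set.univ : Set (Rep K d)) := by
    convert! Rep.isIrreducible_range (K := K) (d := d) (fun c => X c)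
    refine (Set.eq_univ_of_forall fun A : Rep K d => ?_).symm
    exact ⟨A.toPoint, by simp⟩
  exact (irreducibleSpace_def _).2 this

/-- The ideal of polynomials vanishing on a set of representations. -/
def Rep.vanishing (S : Set (Rep K d)) : Ideal (MvPolynomial (Coord d) K) :=
  vanishingIdeal K (Rep.toPoint '' S)

theorem Rep.mem_vanishing {S : Set (Rep K d)} {f : MvPolynomial (Coord d) K} :
    f ∈ Rep.vanishing S ↔ ∀ A ∈ S, eval A.toPoint f = 0 := by
  simp [Rep.vanishing, aeval_eq_eval]

theorem Rep.isPrime_vanishing {S : Set (Rep K d)} (hS : IsIrreducible S) :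
    (Rep.vanishing S).IsPrime := by
  refine ⟨fun h => ?_, fun {f g} hfg => ?_⟩
  · obtain ⟨A, hA⟩ := hS.nonempty
    have := Rep.mem_vanishing.1 ((Ideal.eq_top_iff_one _).1 h) A hA
    simp at this
  · have h := isPreirreducible_iff_isClosed_union_isClosed.1 hS.isPreirreducible _ _
      (Rep.isClosed_zeros {f}) (Rep.isClosed_zeros {g}) fun A hA => by
        have := Rep.mem_vanishing.1 hfg A hA
        rw [map_mul, mul_eq_zero] at this
        simpa using this
    simp only [Rep.mem_vanishing]
    exact h.imp (fun h A hA => h hA f rfl) (fun h A hA => h hA g rfl)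

/-- The prime ideal of an irreducible closed set of representations. -/
def Rep.vanishingPrime (S : TopologicalSpace.IrreducibleCloseds (Rep K d)) :
    PrimeSpectrum (MvPolynomial (Coord d) K) :=
  ⟨Rep.vanishing (S : Set (Rep K d)), Rep.isPrime_vanishing S.isIrreducible⟩

theorem Rep.vanishing_strictAnti {S T : Set (Rep K d)} (hS : IsClosed S) (h : S ⊂ T) :
    Rep.vanishing T < Rep.vanishing S := by
  refine lt_of_le_not_ge
    (fun f hf => Rep.mem_vanishing.2 fun A hA => Rep.mem_vanishing.1 hf A (h.1 hA)) fun hle => ?_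
  obtain ⟨P, rfl⟩ := (Rep.isClosed_iff _).1 hS
  obtain ⟨A, hA, hn⟩ := Set.not_subset.1 h.2
  exact hn fun f hf => Rep.mem_vanishing.1 (hle (Rep.mem_vanishing.2 fun B hB => hB f hf)) A hA

/-- Taking vanishing ideals reverses strict inclusions of closed sets, so a chain of irreducible
closed sets above `S` becomes a chain of primes below its ideal. Only this inequality is needed,
since lower bounds for the codimension come from explicit chains. -/
theorem Rep.coheight_le_height (S : TopologicalSpace.IrreducibleCloseds (Rep K d)) :
    Order.coheight S ≤ (Rep.vanishing (S : Set (Rep K d))).height := by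
  have := Rep.isPrime_vanishing S.isIrreducible
  have h := Order.height_le_height_apply_of_strictMono
    (fun T : (TopologicalSpace.IrreducibleCloseds (Rep K d))ᵒᵈ =>
      Rep.vanishingPrime (OrderDual.ofDual T))
    (fun T U hTU => Rep.vanishing_strictAnti (OrderDual.ofDual U).isClosed hTU) (OrderDual.toDual S)
  exact h.trans (PrimeSpectrum.height_eq_orderHeight (Rep.vanishingPrime S)).ge

/-- An upper bound for the codimension of an irreducible set `S` that is contained in the zero set
of `m` polynomials, and is equal to it outside of the zeros of one more polynomial. -/
theorem Rep.coheight_le_of_zeros [IsAlgClosed K]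
    (S : TopologicalSpace.IrreducibleCloseds (Rep K d)) {m : ℕ}
    (g : Fin m → MvPolynomial (Coord d) K) (δ : MvPolynomial (Coord d) K)
    (hg : ∀ A ∈ S, ∀ k, eval A.toPoint (g k) = 0) (hδ : ∃ A ∈ S, eval A.toPoint δ ≠ 0)
    (h : ∀ A : Rep K d, (∀ k, eval A.toPoint (g k) = 0) → eval A.toPoint δ ≠ 0 → A ∈ S) :
    Order.coheight S ≤ m := by
  refine (Rep.coheight_le_height S).trans ?_
  have hp := Rep.isPrime_vanishing S.isIrreducible
  -- For a prime `q` between the ideal of the `g k` and that of `S`, and `f` vanishing on `S`, the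
  -- product `f * δ` vanishes on all common zeros of the `g k`. By the Nullstellensatz it lies in
  -- `q`, while `δ` does not. Krull's height theorem then bounds the height by `m`.
  have hmin : Rep.vanishing (S : Set (Rep K d)) ∈ (Ideal.span (Set.range g)).minimalPrimes := by
    refine ⟨⟨hp, Ideal.span_le.2 ?_⟩, ?_⟩
    · rintro _ ⟨k, rfl⟩
      exact Rep.mem_vanishing.2 fun A hA => hg A hA k
    · rintro q ⟨hq, hgq⟩ hqp f hf
      have hmem : f * δ ∈ vanishingIdeal K (zeroLocus K (Ideal.span (Set.range g))) := by
        rw [zeroLocus_span]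
        intro x hx
        by_cases hx' : eval x δ = 0
        · rw [aeval_eq_eval, map_mul]
          exact mul_eq_zero_of_right _ hx'
        · have := Rep.mem_vanishing.1 hf (Rep.ofPoint x) (h (Rep.ofPoint x)
            (fun k => by simpa [aeval_eq_eval] using hx (g k) ⟨k, rfl⟩) (by simpa using hx'))
          rw [Rep.toPoint_ofPoint] at this
          rw [aeval_eq_eval, map_mul]
          exact mul_eq_zero_of_left this _
      rw [vanishingIdeal_zeroLocus_eq_radical] at hmem
      rcases hq.mem_or_mem ((hq.radical_le_iff.2 hgq) hmem) with h | h
      · exact h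
      · obtain ⟨A, hA, hA'⟩ := hδ
        exact absurd (Rep.mem_vanishing.1 (hqp h) A hA) hA'
  refine (Ideal.height_le_card_of_mem_minimalPrimes_span (Set.finite_range g) hmin).trans ?_
  rw [← Set.image_univ]
  exact_mod_cast (Set.ncard_image_le Set.finite_univ).trans (by simp)

end Zariski

/-- If a subspace is the union of finitely many irreducible closed sets, none of them contained in
another one, then these sets are its irreducible components. -/
theorem components_eq_range {X ι : Type*} [TopologicalSpace X] [Finite ι] {Y : Set X}
    {V : ι → Set X} (hY : Y = ⋃ i, V i) (hV : ∀ i, IsIrreducible (V i))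
    (hc : ∀ i, IsClosed (V i)) (hne : ∀ i j, V i ⊆ V j → i = j) :
    components Y = Set.range V := by
  have hVY : ∀ i, V i ⊆ Y := fun i => hY ▸ Set.subset_iUnion V i
  have cover : ∀ Z : Set X, IsIrreducible Z → Z ⊆ Y → ∃ i, Z ⊆ V i := by
    intro Z hZ hZY
    have := Fintype.ofFinite ι
    classical
    obtain ⟨_, hi, hZi⟩ := isIrreducible_iff_sUnion_isClosed.1 hZ (Finset.univ.image V)
      (by simpa using hc) (by simpa [← hY] using hZY)
    obtain ⟨i, -, rfl⟩ := Finset.mem_image.1 hi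
    exact ⟨i, hZi⟩
  have hpre : ∀ i, IsIrreducible (Subtype.val ⁻¹' V i : Set Y) := by
    refine fun i => ⟨?_, ?_⟩
    · obtain ⟨x, hx⟩ := (hV i).nonempty
      exact ⟨⟨x, hVY i hx⟩, hx⟩
    · rintro _ _ ⟨u, hu, rfl⟩ ⟨w, hw, rfl⟩ ⟨x, hx, hxu⟩ ⟨y, hy, hyw⟩
      obtain ⟨z, hz, hz'⟩ := (hV i).isPreirreducible u w hu hw ⟨x, hx, hxu⟩ ⟨y, hy, hyw⟩
      exact ⟨⟨z, hVY i hz⟩, hz, hz'⟩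
  have himg : ∀ i, Subtype.val '' (Subtype.val ⁻¹' V i : Set Y) = V i := fun i => by
    rw [Subtype.image_preimage_coe, Set.inter_eq_right.2 (hVY i)]
  ext Z
  constructor
  · rintro ⟨W, hW, rfl⟩
    obtain ⟨i, hi⟩ := cover _ (hW.1.image _ continuous_subtype_val.continuousOn)
      (Subtype.coe_image_subset Y W)
    refine ⟨i, ?_⟩
    have := Set.Subset.antisymm (Set.image_subset_iff.1 hi) (hW.2 (hpre i) (Set.image_subset_iff.1 hi))
    rw [this]
    exact (himg i).symm
  · rintro ⟨i, rfl⟩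
    refine ⟨_, ⟨hpre i, fun W hW hiW => ?_⟩, himg i⟩
    obtain ⟨j, hj⟩ := cover _ (hW.image _ continuous_subtype_val.continuousOn)
      (Subtype.coe_image_subset Y W)
    have hij : V i ⊆ V j := (himg i).ge.trans ((Set.image_mono hiW).trans hj)
    obtain rfl := hne i j hij
    exact Set.image_subset_iff.1 hj

end TypeA
-- Determinantal loci: matrices with a nontrivial kernel
namespace TypeA

open MvPolynomial

/-- A matrix all of whose maximal minors vanish has a nontrivial kernel. -/
theorem exists_mulVec_eq_zero_of_minors {K ι : Type*} [Field K] {r : ℕ} (M : Matrix ι (Fin r) K)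
    (h : ∀ f : Fin r → ι, (M.submatrix f id).det = 0) : ∃ v ≠ 0, M.mulVec v = 0 := by
  by_cases hs : Submodule.span K (Set.range M.row) = ⊤
  · exfalso
    obtain ⟨b, hb, hspan, hli⟩ := exists_linearIndependent K (Set.range M.row)
    let B : Module.Basis b K (Fin r → K) := .mk hli (by rw [Subtype.range_coe, hspan, hs])
    have e : Fin r ≃ b := (Pi.basisFun K (Fin r)).indexEquiv B
    choose f hf using fun i => hb (e i).2
    have hli' : LinearIndependent K (M.submatrix f id).row := by
      have := hli.comp e e.injective
      convert! this using 1
      exact _root_.funext hf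
    have := (Matrix.isUnit_iff_isUnit_det _).1 (Matrix.linearIndependent_rows_iff_isUnit.1 hli')
    rw [h f] at this
    simp at this
  -- A functional vanishing on the span of the rows is, in coordinates, a kernel vector.
  · obtain ⟨φ, hφ, hle⟩ := Submodule.exists_le_ker_of_lt_top _ (lt_top_iff_ne_top.2 hs)
    have key : ∀ x : Fin r → K, φ x = ∑ b, x b * φ (Pi.single b 1) := fun x => by
      conv_lhs => rw [pi_eq_sum_univ' x]
      simp [map_sum]
    refine ⟨fun b => φ (Pi.single b 1), fun h0 => hφ (LinearMap.ext fun x => ?_), ?_⟩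
    · rw [key]
      simp [fun b => congrFun h0 b]
    · ext a
      exact (key (M a)).symm.trans (hle (Submodule.subset_span ⟨a, rfl⟩))

section KerLocus

variable {n : ℕ} {K : Type*} [Field K] {d : Fin (n + 1) → ℕ} {q m : ℕ}

/-- For a matrix of coordinates, the representations for which the first `s` rows of this matrix have
linearly dependent columns. -/
def kerLocus (K : Type*) [Field K] (e : Fin m × Fin (q + 1) → Coord d) (s : ℕ) :
    Set (Rep K d) :=
  {A | ∃ v : Fin (q + 1) → K, v ≠ 0 ∧
    ∀ a : Fin m, (a : ℕ) < s → ∑ b, A.toPoint (e (a, b)) * v b = 0}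

theorem eval_det_X (e : Fin m × Fin (q + 1) → Coord d) (f : Fin (q + 1) → Fin m) (A : Rep K d) :
    eval A.toPoint (Matrix.det (.of fun i j => X (e (f i, j)))) =
      Matrix.det (.of fun i j => A.toPoint (e (f i, j))) := by
  rw [RingHom.map_det]
  congr 1
  ext i j
  simp

theorem isClosed_kerLocus (e : Fin m × Fin (q + 1) → Coord d) (s : ℕ) :
    IsClosed (kerLocus K e s) := by
  convert! Rep.isClosed_zeros (K := K) (d := d)
    {g | ∃ f : Fin (q + 1) → Fin m, (∀ i, (f i : ℕ) < s) ∧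
      g = Matrix.det (.of fun i j => X (e (f i, j)))} using 1
  ext A
  constructor
  · rintro ⟨v, hv, h⟩ _ ⟨f, hf, rfl⟩
    rw [eval_det_X]
    refine Matrix.exists_mulVec_eq_zero_iff.1 ⟨v, hv, ?_⟩
    ext i
    exact h (f i) (hf i)
  · intro h
    obtain ⟨v, hv, h⟩ := exists_mulVec_eq_zero_of_minors
      (.of fun (a : {a : Fin m // (a : ℕ) < s}) b => A.toPoint (e (a, b))) fun f =>
        (eval_det_X e (fun i => f i) A).symm.trans (h _ ⟨_, fun i => (f i).2, rfl⟩)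
    exact ⟨v, hv, fun a ha => congrFun h ⟨a, ha⟩⟩

open Classical in
/-- The locus is parametrized by the factorizations `B * C` of the first `s` rows with inner
dimension `q`, and by the remaining coordinates. -/
theorem isIrreducible_kerLocus [Infinite K] {e : Fin m × Fin (q + 1) → Coord d}
    (he : Function.Injective e) (s : ℕ) : IsIrreducible (kerLocus K e s) := by
  let P : Coord d → MvPolynomial (Coord d ⊕ (Fin m × Fin q) ⊕ (Fin q × Fin (q + 1))) K := fun c =>
    if h : ∃ p : Fin m × Fin (q + 1), (p.1 : ℕ) < s ∧ e p = c then
      ∑ j, X (.inr (.inl (h.choose.1, j))) * X (.inr (.inr (j, h.choose.2)))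
    else X (.inl c)
  have hP : ∀ (a : Fin m) (b : Fin (q + 1)), (a : ℕ) < s →
      P (e (a, b)) = ∑ j, X (.inr (.inl (a, j))) * X (.inr (.inr (j, b))) := by
    intro a b ha
    have h : ∃ p : Fin m × Fin (q + 1), (p.1 : ℕ) < s ∧ e p = e (a, b) := ⟨(a, b), ha, rfl⟩
    simp only [P, dif_pos h]
    rw [he h.choose_spec.2]
  convert! Rep.isIrreducible_range P
  ext A
  constructor
  · rintro ⟨v, hv, h⟩
    obtain ⟨b₀, hb₀⟩ := Function.ne_iff.1 hv
    rw [Pi.zero_apply] at hb₀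
    -- Column `b₀` is a combination of the others because `v b₀ ≠ 0`. So `B` consists of the other
    -- `q` columns, and `C` is the identity on them, with the coefficients of the combination in
    -- column `b₀`.
    refine ⟨Sum.elim A.toPoint (Sum.elim (fun p => A.toPoint (e (p.1, b₀.succAbove p.2)))
      fun p => if p.2 = b₀ then - v (b₀.succAbove p.1) / v b₀ else
        if p.2 = b₀.succAbove p.1 then 1 else 0), ?_⟩
    have : ∀ B : Rep K d, B.toPoint = A.toPoint → B = A := fun B h => by
      rw [← B.ofPoint_toPoint, h, A.ofPoint_toPoint]
    refine this _ (funext fun c => ?_)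
    rw [Rep.toPoint_ofPoint]
    by_cases hc : ∃ p : Fin m × Fin (q + 1), (p.1 : ℕ) < s ∧ e p = c
    · obtain ⟨⟨a, b⟩, ha, rfl⟩ := hc
      simp only at ha
      rw [hP a b ha]
      simp only [map_sum, map_mul, eval_X, Sum.elim_inr, Sum.elim_inl]
      have hab := h a ha
      rw [Fin.sum_univ_succAbove _ b₀] at hab
      rcases Fin.eq_self_or_eq_succAbove b₀ b with rfl | ⟨j, rfl⟩
      · simp only [if_true, mul_div_assoc', mul_neg, ← Finset.sum_div, Finset.sum_neg_distrib]
        rw [div_eq_iff hb₀]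
        linear_combination -hab
      · simp [Fin.succAbove_ne]
    · simp only [P, dif_neg hc, eval_X, Sum.elim_inl]
  · rintro ⟨y, rfl⟩
    -- Padding `C` by a zero row makes it a singular square matrix, whose kernel is also killed by
    -- `B * C`.
    obtain ⟨v, hv, h⟩ := Matrix.exists_mulVec_eq_zero_iff.2
      (show Matrix.det (.of fun (i j : Fin (q + 1)) =>
        if h : (i : ℕ) < q then y (.inr (.inr (⟨i, h⟩, j))) else 0) = 0 from
        Matrix.det_eq_zero_of_row_eq_zero (Fin.last q) fun j => by simp)
    refine ⟨v, hv, fun a ha => ?_⟩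
    simp only [Rep.toPoint_ofPoint, hP a _ ha, map_sum, map_mul, eval_X, Finset.sum_mul]
    rw [Finset.sum_comm]
    refine Finset.sum_eq_zero fun j _ => ?_
    have := congrFun h j.castSucc
    simp only [Matrix.mulVec, dotProduct, Matrix.of_apply, Fin.val_castSucc, j.2, dif_pos,
      Pi.zero_apply] at this
    simp only [mul_assoc, ← Finset.mul_sum]
    rw [this, mul_zero]

/-- The locus as an irreducible closed set. -/
def kerLocusCloseds (K : Type*) [Field K] [Infinite K] {e : Fin m × Fin (q + 1) → Coord d}
    (he : Function.Injective e) (s : ℕ) : TopologicalSpace.IrreducibleCloseds (Rep K d) :=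
  ⟨kerLocus K e s, isIrreducible_kerLocus he s, isClosed_kerLocus e s⟩

open Classical in
-- The loci are separated by the matrix with an identity block in the first `q` rows and columns and
-- one further `1` at position `(s, q)`: the last basis vector is killed by the rows before `s`, but
-- row `s` leaves no kernel.
theorem kerLocus_ssubset {e : Fin m × Fin (q + 1) → Coord d} (he : Function.Injective e) {s : ℕ}
    (hq : q ≤ s) (hs : s < m) : kerLocus K e (s + 1) ⊂ kerLocus K e s := by
  refine ⟨fun A ⟨v, hv, h⟩ => ⟨v, hv, fun a ha => h a (by omega)⟩, fun hsub => ?_⟩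
  let A : Rep K d := Rep.ofPoint fun c => if ∃ p : Fin m × Fin (q + 1), e p = c ∧
    ((p.1 : ℕ) = p.2 ∧ (p.1 : ℕ) < q ∨ (p.1 : ℕ) = s ∧ (p.2 : ℕ) = q) then 1 else 0
  have hA : ∀ a b, A.toPoint (e (a, b)) =
      if (a : ℕ) = b ∧ (a : ℕ) < q ∨ (a : ℕ) = s ∧ (b : ℕ) = q then 1 else 0 := by
    intro a b
    simp only [A, Rep.toPoint_ofPoint]
    congr 1
    refine propext ⟨fun ⟨p, hp, h⟩ => ?_, fun h => ⟨_, rfl, h⟩⟩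
    obtain rfl := he hp
    exact h
  obtain ⟨v, hv, h⟩ := hsub (show A ∈ kerLocus K e s from
    ⟨Pi.single (Fin.last q) 1, by simp, fun a ha => by
      rw [Finset.sum_eq_single (Fin.last q) (fun b _ hb => by simp [hb]) (by simp), hA, if_neg,
        zero_mul]
      rintro (⟨h, h'⟩ | ⟨h, -⟩)
      · simp at h
        omega
      · omega⟩)
  refine hv (funext fun b => ?_)
  by_cases hb : (b : ℕ) < q
  · have := h ⟨b, by omega⟩ (by simp; omega)
    simp only [hA] at this
    rw [Finset.sum_eq_single b (fun b' _ hb' => ?_) (by simp)] at this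
    · simpa [hb] using this
    · rw [if_neg, zero_mul]
      rintro (⟨h, -⟩ | ⟨h, -⟩)
      · exact hb' (Fin.ext h.symm)
      · exact absurd h (by omega)
  · have hb : b = Fin.last q := Fin.ext (by simp; omega)
    subst hb
    have := h ⟨s, hs⟩ (by simp)
    simp only [hA] at this
    rw [Finset.sum_eq_single (Fin.last q) (fun b' _ hb' => ?_) (by simp)] at this
    · simpa using this
    · rw [if_neg, zero_mul]
      have := Fin.val_ne_of_ne hb'
      rw [Fin.val_last] at this
      omega

theorem le_coheight_kerLocus [Infinite K] {e : Fin m × Fin (q + 1) → Coord d}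
    (he : Function.Injective e) (k : ℕ) (hk : q + k ≤ m) :
    (k : ℕ∞) ≤ Order.coheight (kerLocusCloseds K he (q + k)) := by
  induction k with
  | zero => simp
  | succ k ih =>
    refine le_trans ?_ (Order.coheight_add_one_le (a := kerLocusCloseds K he (q + k)) ?_)
    · push_cast
      gcongr
      exact ih (by omega)
    · exact kerLocus_ssubset (s := q + k) he (by omega) (by omega)

/-- The upper bound for the codimension: off the zeros of a minor of size `q`, the vanishing of all
maximal minors follows from that of the maximal minors containing its rows. -/
theorem coheight_kerLocus_le [IsAlgClosed K] {e : Fin m × Fin (q + 1) → Coord d}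
    (he : Function.Injective e) (k : ℕ) (hk : q + k = m) :
    Order.coheight (kerLocusCloseds K he m) ≤ k := by
  classical
  let rows (a : Fin m) : Fin (q + 1) → Fin m := Fin.snoc (fun i : Fin q => ⟨i, by omega⟩) a
  let top : Fin q → Fin m := fun i => ⟨i, by omega⟩
  refine Rep.coheight_le_of_zeros _
    (fun a : Fin k => Matrix.det (.of fun i j => X (e (rows ⟨q + a, by omega⟩ i, j))))
    (Matrix.det (.of fun i j : Fin q => X (e (top i, j.castSucc)))) ?_ ?_ ?_
  · rintro A ⟨v, hv, h⟩ a
    rw [eval_det_X]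
    refine Matrix.exists_mulVec_eq_zero_iff.1 ⟨v, hv, ?_⟩
    ext i
    exact h (rows ⟨q + a, by omega⟩ i) (by omega)
  · let A : Rep K d := Rep.ofPoint fun c => if ∃ p : Fin m × Fin (q + 1), e p = c ∧
      ((p.1 : ℕ) = p.2 ∧ (p.1 : ℕ) < q) then 1 else 0
    have hA : ∀ a b, A.toPoint (e (a, b)) = if (a : ℕ) = b ∧ (a : ℕ) < q then 1 else 0 := by
      intro a b
      simp only [A, Rep.toPoint_ofPoint]
      congr 1
      refine propext ⟨fun ⟨p, hp, h⟩ => ?_, fun h => ⟨_, rfl, h⟩⟩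
      obtain rfl := he hp
      exact h
    refine ⟨A, ⟨Pi.single (Fin.last q) 1, by simp, fun a ha => ?_⟩, ?_⟩
    · rw [Finset.sum_eq_single (Fin.last q) (fun b _ hb => by simp [hb]) (by simp), hA, if_neg,
        zero_mul]
      simp
      omega
    · rw [RingHom.map_det]
      have : (eval A.toPoint).mapMatrix (.of fun i j : Fin q => X (e (top i, j.castSucc))) = 1 := by
        ext i j
        simp [hA, Matrix.one_apply, top, Fin.ext_iff]
      rw [this, Matrix.det_one]
      exact one_ne_zero
  · intro A hg hδ
    -- The cofactors along the last row. By Laplace expansion, pairing `w` with row `a` gives the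
    -- minor bordered by row `a`; it is zero by assumption for `a ≥ q`, and by a repeated row for `a
    -- < q`. The last entry of `w` is the nonzero `q`-minor.
    let w : Fin (q + 1) → K := fun b => (-1) ^ (q + (b : ℕ)) *
      Matrix.det (.of fun i j : Fin q => A.toPoint (e (top i, b.succAbove j)))
    have hw : ∀ a : Fin m, ∑ b, A.toPoint (e (a, b)) * w b =
        Matrix.det (.of fun i j => A.toPoint (e (rows a i, j))) := by
      intro a
      rw [Matrix.det_succ_row _ (Fin.last q)]
      refine Finset.sum_congr rfl fun b _ => ?_
      simp only [w, rows, Matrix.of_apply, Fin.snoc_last, Fin.val_last]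
      rw [mul_left_comm, mul_assoc]
      congr 3
      ext i j
      simp [top, Fin.succAbove_last]
    refine ⟨w, fun h0 => hδ ?_, fun a _ => ?_⟩
    · have := congrFun h0 (Fin.last q)
      simp only [w, Fin.succAbove_last, Pi.zero_apply, mul_eq_zero, pow_eq_zero_iff', neg_eq_zero,
        one_ne_zero, false_and, false_or] at this
      rw [RingHom.map_det, ← this]
      congr 1
      ext i j
      simp
    · rw [hw]
      by_cases ha : (a : ℕ) < q
      · refine Matrix.det_zero_of_row_eq (i := (⟨a, ha⟩ : Fin q).castSucc) (j := Fin.last q)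
          (Fin.castSucc_lt_last _).ne ?_
        ext j
        simp only [rows, Matrix.of_apply, Fin.snoc_last, Fin.snoc_castSucc]
      · have := hg ⟨a - q, by omega⟩
        rw [eval_det_X] at this
        rwa [show (⟨q + (a - q), by omega⟩ : Fin m) = a from Fin.ext (by simp only; omega)] at this

theorem coheight_kerLocus [IsAlgClosed K] {e : Fin m × Fin (q + 1) → Coord d}
    (he : Function.Injective e) (k : ℕ) (hk : q + k = m) :
    Order.coheight (kerLocusCloseds K he m) = k := by
  subst hk
  exact le_antisymm (coheight_kerLocus_le he k rfl) (le_coheight_kerLocus he k le_rfl)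

end KerLocus

end TypeA
namespace TypeA

/-! ### The sets `I(d)` and `J(d)` for concave vectors -/

section Combinatorics

variable {n : ℕ} {d : Fin (n + 1) → ℕ}

theorem extDim_succ (d : Fin (n + 1) → ℕ) (p : Fin (n + 1)) : extDim d (p + 1) = d p :=
  dif_pos p.2

/-- If `x` and `y` are not adjacent, the vertex after `x` would have to exceed both ends. Concavity
bounds it by `d x` when it is left of `a`, and by `d y` otherwise. -/
theorem J_eq_range (hd : IsConcave d) :
    J d = Set.range (fun i : Fin n => (i.castSucc, i.succ)) := by
  obtain ⟨a, ha, hb⟩ := hd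
  ext ⟨x, y⟩
  constructor
  · rintro ⟨hxy, h⟩
    simp only at hxy h
    rw [Fin.lt_def] at hxy
    by_cases hy : (y : ℕ) = x + 1
    · exact ⟨⟨x, by omega⟩, Prod.ext (Fin.ext rfl) (Fin.ext hy.symm)⟩
    · let l : Fin (n + 1) := ⟨x + 1, by omega⟩
      have hxl : x < l := Fin.lt_def.2 (by simp [l])
      have hly : l < y := Fin.lt_def.2 (by simp only [l]; omega)
      have := max_lt_iff.1 (h l hxl hly)
      rcases le_total l a with hl | hl
      · exact absurd (ha (hxl.le.trans hl) hl hxl.le) this.1.not_ge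
      · exact absurd (hb hl (hl.trans hly.le) hly.le) this.2.not_ge
  · rintro ⟨i, hi⟩
    obtain ⟨rfl, rfl⟩ := Prod.ext_iff.1 hi
    refine ⟨i.castSucc_lt_succ, fun l h₁ h₂ => ?_⟩
    simp only [Fin.lt_def, Fin.val_castSucc, Fin.val_succ] at h₁ h₂
    omega

/-- A strict increase happens only from `a` onwards, so nothing further right is smaller; the first
smaller entry is the artificial `0` at index `t + 1 = n + 2`. `leftCond_of_lt` is the mirror image,
with index `0`. -/
theorem rightCond_of_lt {a : Fin (n + 1)} (ha : AntitoneOn d (Set.Iic a))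
    (hb : MonotoneOn d (Set.Ici a)) (hpos : ∀ i, 0 < d i) {i : Fin n}
    (hi : d i.castSucc < d i.succ) : RightCond d i.castSucc i.succ := by
  have hai : a ≤ i.castSucc := by
    by_contra! h
    exact absurd (ha h.le (Fin.castSucc_lt_iff_succ_le.1 h) i.castSucc_lt_succ.le) hi.not_ge
  have key : ∀ l : ℕ, (i.succ : ℕ) + 1 < l → l < n + 2 → d i.succ ≤ extDim d l := by
    intro l hl hl'
    obtain ⟨p, rfl⟩ := Nat.exists_eq_succ_of_ne_zero (n := l) (by omega)
    have hp := extDim_succ d ⟨p, by omega⟩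
    simp only [Nat.succ_eq_add_one] at hp hl ⊢
    rw [hp]
    have h : i.succ ≤ (⟨p, by omega⟩ : Fin (n + 1)) := Fin.le_def.2 (by simp only; omega)
    have hai' := hai.trans i.castSucc_lt_succ.le
    exact hb hai' (hai'.trans h) h
  refine ⟨n + 2, ⟨⟨?_, ?_⟩, fun x hx => ?_⟩, key⟩
  · rw [Fin.val_succ]
    omega
  · simpa [extDim] using hpos _
  · by_contra! h
    exact absurd (key x hx.1 h) (hx.2.trans hi).not_ge

theorem leftCond_of_lt {a : Fin (n + 1)} (ha : AntitoneOn d (Set.Iic a))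
    (hb : MonotoneOn d (Set.Ici a)) (hpos : ∀ i, 0 < d i) {i : Fin n}
    (hi : d i.succ < d i.castSucc) : LeftCond d i.castSucc i.succ := by
  have hai : i.succ ≤ a := by
    by_contra! h
    exact absurd (hb (Fin.le_castSucc_iff.2 h) h.le i.castSucc_lt_succ.le) hi.not_ge
  have key : ∀ l : ℕ, 0 < l → l < (i.castSucc : ℕ) + 1 → d i.castSucc ≤ extDim d l := by
    intro l hl hl'
    obtain ⟨p, rfl⟩ := Nat.exists_eq_succ_of_ne_zero hl.ne'
    rw [Fin.val_castSucc] at hl'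
    have hp := extDim_succ d ⟨p, by omega⟩
    simp only [Nat.succ_eq_add_one] at hp hl' ⊢
    rw [hp]
    have h : (⟨p, by omega⟩ : Fin (n + 1)) ≤ i.castSucc :=
      Fin.le_def.2 (by rw [Fin.val_castSucc]; simp only; omega)
    have hai' := i.castSucc_lt_succ.le.trans hai
    exact ha (h.trans hai') hai' h
  refine ⟨0, ⟨⟨by omega, hpos _⟩, fun x hx => ?_⟩, key⟩
  by_contra! h
  exact absurd (key x h hx.1) (hx.2.trans hi).not_ge

theorem I_eq_J (hd : IsConcave d) (hpos : ∀ i, 0 < d i) : I d = J d := by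
  refine Set.Subset.antisymm (fun p hp => hp.1) fun p hp => ⟨hp, ?_⟩
  rw [J_eq_range hd] at hp
  obtain ⟨i, rfl⟩ := hp
  obtain ⟨a, ha, hb⟩ := hd
  rcases lt_trichotomy (d i.castSucc) (d i.succ) with h | h | h
  · exact Or.inr (Or.inl ⟨h, rightCond_of_lt ha hb hpos h⟩)
  · exact Or.inl h
  · exact Or.inr (Or.inr ⟨h, leftCond_of_lt ha hb hpos h⟩)

theorem minDim_le {i j l : Fin (n + 1)} (h : i ≤ j) (hi : i ≤ l) (hj : l ≤ j) :
    minDim d i j h ≤ d l :=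
  Finset.inf'_le _ (Finset.mem_Icc.2 ⟨hi, hj⟩)

theorem le_minDim {i j : Fin (n + 1)} (h : i ≤ j) {c : ℕ}
    (hc : ∀ l, i ≤ l → l ≤ j → c ≤ d l) : c ≤ minDim d i j h :=
  Finset.le_inf' _ _ fun l hl => hc l (Finset.mem_Icc.1 hl).1 (Finset.mem_Icc.1 hl).2

theorem minDim_castSucc_succ (i : Fin n) (h : i.castSucc ≤ i.succ) :
    minDim d i.castSucc i.succ h = min (d i.castSucc) (d i.succ) := by
  refine le_antisymm (le_min (minDim_le h le_rfl h) (minDim_le h h le_rfl)) (le_minDim h ?_)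
  intro l hl hl'
  rcases eq_or_lt_of_le hl with rfl | hl
  · exact min_le_left _ _
  · rw [le_antisymm hl' (Fin.castSucc_lt_iff_succ_le.1 hl)]
    exact min_le_right _ _

end Combinatorics

/-! ### Ranks of products along a concave vector -/

section Rank

variable {K : Type*} [Field K]

theorem rank_lt_iff {m r q : ℕ} (M : Matrix (Fin m) (Fin r) K) (hr : r = q + 1) :
    M.rank < r ↔ ∃ v : Fin (q + 1) → K, v ≠ 0 ∧
      ∀ a, ∑ b, M a (Fin.cast hr.symm b) * v b = 0 := by
  subst hr
  have h := M.mulVecLin.finrank_range_add_finrank_ker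
  rw [Module.finrank_fin_fun] at h
  have h' : M.rank < q + 1 ↔ M.mulVecLin.ker ≠ ⊥ := by
    rw [← Submodule.one_le_finrank_iff, Matrix.rank]
    omega
  rw [h', Submodule.ne_bot_iff]
  refine exists_congr fun v => ?_
  rw [and_comm]
  refine and_congr_right fun _ => ?_
  simp [funext_iff, Matrix.mulVec, dotProduct]

theorem rank_mul_eq_left {m l r : ℕ} (M : Matrix (Fin m) (Fin l) K) (N : Matrix (Fin l) (Fin r) K)
    (hN : N.rank = l) : (M * N).rank = M.rank := by
  have h : N.mulVecLin.range = ⊤ := Submodule.eq_top_of_finrank_eq (by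
    rw [Module.finrank_fin_fun]
    exact hN)
  rw [Matrix.rank, Matrix.rank, Matrix.mulVecLin_mul, LinearMap.range_comp_of_range_eq_top _ h]

theorem rank_mul_eq_right {m l r : ℕ} (M : Matrix (Fin m) (Fin l) K)
    (N : Matrix (Fin l) (Fin r) K) (hM : M.rank = l) : (M * N).rank = N.rank := by
  rw [← Matrix.rank_transpose, Matrix.transpose_mul, rank_mul_eq_left _ _
    (by rw [Matrix.rank_transpose, hM]), Matrix.rank_transpose]

/-- The matrix with ones on the diagonal and zeros elsewhere. -/
def diagOne (K : Type*) [Field K] (m r : ℕ) : Matrix (Fin m) (Fin r) K :=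
  .of fun a b => if (a : ℕ) = b then 1 else 0

theorem rank_diagOne_of_le {m r : ℕ} (h : r ≤ m) : (diagOne K m r).rank = r := by
  refine le_antisymm (Matrix.rank_le_width _) ?_
  by_contra! hlt
  obtain ⟨q, rfl⟩ := Nat.exists_eq_succ_of_ne_zero (n := r) (by omega)
  obtain ⟨v, hv, hv'⟩ := (rank_lt_iff _ rfl).1 hlt
  refine hv (funext fun b => ?_)
  have := hv' ⟨b, by omega⟩
  simpa [diagOne, ← Fin.ext_iff] using this

theorem rank_diagOne (m r : ℕ) : (diagOne K m r).rank = min m r := by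
  rcases le_total r m with h | h
  · rw [rank_diagOne_of_le h, min_eq_right h]
  · have : (diagOne K m r) = (diagOne K r m).transpose := by
      ext a b
      simp [diagOne, eq_comm]
    rw [this, Matrix.rank_transpose, rank_diagOne_of_le h, min_eq_left h]

variable {n : ℕ} {d : Fin (n + 1) → ℕ}

theorem Rep.rk_eq_rank_comp (A : Rep K d) (i : Fin (n + 1)) (m : ℕ) (h : (i : ℕ) + m < n + 1)
    (j : Fin (n + 1)) (hi : i ≤ j) (hj : (j : ℕ) = i + m) : A.rk i j hi = (A.comp i m h).rank := by
  unfold Rep.rk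
  have : ∀ m' (h' : (i : ℕ) + m' < n + 1), m' = m → (A.comp i m' h').rank = (A.comp i m h).rank := by
    rintro _ h' rfl
    rfl
  exact this _ _ (by omega)

theorem Rep.rk_castSucc_succ (A : Rep K d) (i : Fin n) (h : i.castSucc ≤ i.succ) :
    A.rk i.castSucc i.succ h = (A i).rank := by
  have := A.rk_eq_rank_comp i.castSucc 1 (by simp) _ h (by simp)
  refine this.trans ?_
  change (((1 : Matrix (Fin (d i.castSucc)) (Fin (d i.castSucc)) K)) * A i).rank = _
  rw [Matrix.one_mul]

theorem Rep.comp_eq_zero (A : Rep K d) {l : Fin n} (hl : A l = 0) (i : Fin (n + 1)) (m : ℕ)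
    (h : (i : ℕ) + m < n + 1) (hil : (i : ℕ) ≤ l) (hlm : (l : ℕ) < i + m) : A.comp i m h = 0 := by
  induction m with
  | zero => omega
  | succ m ih =>
    change A.comp i m _ * A.mat (i + m) h = 0
    by_cases hm : (l : ℕ) = i + m
    · have : A ⟨i + m, by omega⟩ = 0 := by
        rwa [show (⟨i + m, by omega⟩ : Fin n) = l from Fin.ext hm.symm]
      have : A.mat (i + m) h = 0 := this
      rw [this, Matrix.mul_zero]
    · rw [ih (by omega) (by omega), Matrix.zero_mul]

/-- If the maps of `A` between `i` and `j` have maximal rank, then so has their product. -/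
theorem Rep.rank_comp (hd : IsConcave d) (A : Rep K d) (i : Fin (n + 1)) (m : ℕ)
    (h : (i : ℕ) + m < n + 1) (hi : i ≤ ⟨i + m, h⟩)
    (hA : ∀ l : Fin n, (i : ℕ) ≤ l → (l : ℕ) < i + m →
      (A l).rank = min (d l.castSucc) (d l.succ)) :
    (A.comp i m h).rank = minDim d i ⟨i + m, h⟩ hi := by
  obtain ⟨a, ha, hb⟩ := hd
  induction m with
  | zero =>
    change (1 : Matrix (Fin (d i)) (Fin (d i)) K).rank = _
    rw [Matrix.rank_one, Fintype.card_fin]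
    refine le_antisymm (le_minDim _ fun l h₁ h₂ => ?_) (minDim_le _ le_rfl hi)
    rw [le_antisymm (Fin.le_def.2 (Fin.le_def.1 h₂)) h₁]
    rfl
  | succ m ih =>
    let x : Fin (n + 1) := ⟨i + m, by omega⟩
    let y : Fin (n + 1) := ⟨i + (m + 1), h⟩
    have hix : i ≤ x := Fin.le_def.2 (by simp [x])
    have hxy : x ≤ y := Fin.le_def.2 (by simp only [x, y]; omega)
    have ih := ih (by omega) hix fun l h₁ h₂ => hA l h₁ (by omega)
    have hmat : (A.mat (i + m) h).rank = min (d x) (d y) :=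
      hA ⟨i + m, by omega⟩ (by simp) (by simp)
    have hle : ∀ l, l ≤ y → l ≤ x ∨ l = y := by
      intro l hl
      by_cases hlx : l ≤ x
      · exact .inl hlx
      · refine .inr (le_antisymm hl (Fin.le_def.2 ?_))
        rw [Fin.le_def] at hlx
        simp only [x, y] at hlx ⊢
        omega
    change (A.comp i m _ * A.mat (i + m) h).rank = minDim d i y _
    -- From `a` on, the new factor is surjective and leaves the rank unchanged. Before `a`, the
    -- product so far has rank `d x`, so it is injective and the rank is that of the new factor.
    rcases le_or_gt a x with hax | hax
    · have hd' : d x ≤ d y := hb hax (hax.trans hxy) hxy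
      rw [rank_mul_eq_left _ _ (hmat.trans (min_eq_left hd')), ih]
      refine le_antisymm (le_minDim _ fun l h₁ h₂ => ?_)
        (le_minDim _ fun l h₁ h₂ => minDim_le _ h₁ (h₂.trans hxy))
      rcases hle l h₂ with h₂ | rfl
      · exact minDim_le _ h₁ h₂
      · exact (minDim_le _ hix le_rfl).trans hd'
    · have hya : y ≤ a := by
        rw [Fin.lt_def] at hax
        rw [Fin.le_def]
        simp only [x, y] at hax ⊢
        omega
      have hd' : d y ≤ d x := ha hax.le hya hxy
      have : minDim d i x hix = d x := le_antisymm (minDim_le _ hix le_rfl)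
        (le_minDim _ fun l _ h₂ => ha (h₂.trans hax.le) hax.le h₂)
      rw [rank_mul_eq_right _ _ (ih.trans this), hmat, min_eq_right hd']
      exact le_antisymm (le_minDim _ fun l h₁ h₂ => ha (h₂.trans hya) hya h₂)
        (minDim_le _ (hix.trans hxy) le_rfl)

end Rank

/-! ### Irreducible components of `Y` and reducibility of `Y_{i,j}` -/

section Components

variable {n : ℕ} {K : Type*} [Field K] {d : Fin (n + 1) → ℕ}

theorem mem_Yij_succ {A : Rep K d} {i : Fin n} :
    A ∈ Yij K d i.castSucc i.succ i.castSucc_lt_succ ↔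
      (A i).rank < min (d i.castSucc) (d i.succ) := by
  change A.rk _ _ _ < minDim d _ _ _ ↔ _
  rw [A.rk_castSucc_succ, minDim_castSucc_succ]

theorem notMem_Yij_succ {A : Rep K d} {i : Fin n} :
    A ∉ Yij K d i.castSucc i.succ i.castSucc_lt_succ ↔
      (A i).rank = min (d i.castSucc) (d i.succ) := by
  rw [mem_Yij_succ]
  have := le_min (Matrix.rank_le_height (A i)) (Matrix.rank_le_width (A i))
  omega

/-- Here `q + 1` is the smaller and `m` the larger of the two dimensions; the matrix is transposed
if it has fewer rows than columns. Then `m - q` is the expected codimension. -/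
theorem Yij_eq_kerLocus (hpos : ∀ i, 0 < d i) (i : Fin n) :
    ∃ (q m : ℕ) (e : Fin m × Fin (q + 1) → Coord d), Function.Injective e ∧
      q + (((d i.castSucc : ℤ) - (d i.succ : ℤ)).natAbs + 1) = m ∧
      Yij K d i.castSucc i.succ i.castSucc_lt_succ = kerLocus K e m := by
  rcases le_total (d i.succ) (d i.castSucc) with h | h
  · obtain ⟨q, hq⟩ := Nat.exists_eq_succ_of_ne_zero (hpos i.succ).ne'
    refine ⟨q, d i.castSucc, fun p => ⟨i, p.1, Fin.cast hq.symm p.2⟩, ?_, by omega, ?_⟩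
    · rintro ⟨a, b⟩ ⟨a', b'⟩ h
      simpa using h
    · ext A
      rw [mem_Yij_succ, min_eq_right h, rank_lt_iff (A i) hq]
      exact exists_congr fun v => and_congr_right fun _ => forall_congr' fun a =>
        ⟨fun h _ => h, fun h => h a.2⟩
  · obtain ⟨q, hq⟩ := Nat.exists_eq_succ_of_ne_zero (hpos i.castSucc).ne'
    refine ⟨q, d i.succ, fun p => ⟨i, Fin.cast hq.symm p.2, p.1⟩, ?_, by omega, ?_⟩
    · rintro ⟨a, b⟩ ⟨a', b'⟩ h
      simpa [and_comm] using h
    · ext A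
      rw [mem_Yij_succ, min_eq_left h, ← Matrix.rank_transpose, rank_lt_iff (A i).transpose hq]
      exact exists_congr fun v => and_congr_right fun _ => forall_congr' fun a =>
        ⟨fun h _ => h, fun h => h a.2⟩

theorem isClosed_Yij_succ (hpos : ∀ i, 0 < d i) (i : Fin n) :
    IsClosed (Yij K d i.castSucc i.succ i.castSucc_lt_succ) := by
  obtain ⟨q, m, e, -, -, h⟩ := Yij_eq_kerLocus (K := K) hpos i
  exact h ▸ isClosed_kerLocus e m

theorem isIrreducible_Yij_succ [Infinite K] (hpos : ∀ i, 0 < d i) (i : Fin n) :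
    IsIrreducible (Yij K d i.castSucc i.succ i.castSucc_lt_succ) := by
  obtain ⟨q, m, e, he, -, h⟩ := Yij_eq_kerLocus (K := K) hpos i
  exact h ▸ isIrreducible_kerLocus he m

theorem codim_Yij_succ [IsAlgClosed K] (hpos : ∀ i, 0 < d i) (i : Fin n) :
    codim (Yij K d i.castSucc i.succ i.castSucc_lt_succ) =
      ((((d i.castSucc : ℤ) - (d i.succ : ℤ)).natAbs + 1 : ℕ) : ℕ∞) := by
  obtain ⟨q, m, e, he, hm, h⟩ := Yij_eq_kerLocus (K := K) hpos i
  rw [h]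
  exact (codim_irreducibleCloseds (kerLocusCloseds K he m)).trans (coheight_kerLocus he _ hm)

/-- A representation whose only nonzero map is the one at `l`, and this has maximal rank. -/
def Rep.single (K : Type*) [Field K] (d : Fin (n + 1) → ℕ) (l : Fin n) : Rep K d :=
  fun i => if i = l then diagOne K _ _ else 0

theorem Rep.single_notMem_Yij (l : Fin n) :
    Rep.single K d l ∉ Yij K d l.castSucc l.succ l.castSucc_lt_succ := by
  rw [notMem_Yij_succ]
  simp [Rep.single, rank_diagOne]

/-- For `i ≠ j`, `Rep.single K d j` is zero at `i`, hence of too small rank there by positivity of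
`d`, but has maximal rank at `j`. -/
theorem Yij_succ_injective (hpos : ∀ i, 0 < d i) (i j : Fin n)
    (h : Yij K d i.castSucc i.succ i.castSucc_lt_succ ⊆
      Yij K d j.castSucc j.succ j.castSucc_lt_succ) : i = j := by
  by_contra hij
  refine Rep.single_notMem_Yij j (h (mem_Yij_succ.2 ?_))
  simp [Rep.single, hij, hpos]

theorem Yij_subset_iUnion (hd : IsConcave d) (i j : Fin (n + 1)) (h : i < j) :
    {A : Rep K d | A.rk i j h.le ≠ minDim d i j h.le} ⊆
      ⋃ l ∈ {l : Fin n | (i : ℕ) ≤ l ∧ (l : ℕ) < j},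
        Yij K d l.castSucc l.succ l.castSucc_lt_succ := by
  intro A hA
  by_contra hc
  simp only [Set.mem_iUnion, not_exists, notMem_Yij_succ] at hc
  obtain ⟨j, hj⟩ := j
  obtain ⟨m, rfl⟩ := Nat.exists_eq_add_of_le (Fin.le_def.1 h.le)
  exact hA ((A.rk_eq_rank_comp i m hj _ h.le rfl).trans
    (A.rank_comp hd i m _ h.le fun l h₁ h₂ => hc l ⟨h₁, h₂⟩))

theorem Y_eq_iUnion (hd : IsConcave d) :
    Y K d = ⋃ i : Fin n, Yij K d i.castSucc i.succ i.castSucc_lt_succ := by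
  refine Set.Subset.antisymm (fun A hA => ?_) (Set.iUnion_subset fun i A hA hA' => ?_)
  · simp only [Y, genericOrbit, Set.mem_compl_iff, Set.mem_ofPred_eq, not_forall] at hA
    obtain ⟨i, j, h, hA⟩ := hA
    exact Set.iUnion₂_subset_iUnion _ _ (Yij_subset_iUnion hd i j h hA)
  · exact Nat.lt_irrefl _ ((show A.rk _ _ _ < _ from hA).trans_eq (hA' _ _ i.castSucc_lt_succ).symm)

theorem mem_genericOrbit_iff (hd : IsConcave d) {A : Rep K d} :
    A ∈ genericOrbit K d ↔ ∀ i : Fin n, (A i).rank = min (d i.castSucc) (d i.succ) := by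
  rw [← Set.notMem_compl_iff]
  change A ∉ Y K d ↔ _
  simp only [Y_eq_iUnion hd, Set.mem_iUnion, not_exists, notMem_Yij_succ]

theorem isOpen_genericOrbit (hd : IsConcave d) (hpos : ∀ i, 0 < d i) :
    IsOpen (genericOrbit K d) := by
  rw [← isClosed_compl_iff]
  change IsClosed (Y K d)
  rw [Y_eq_iUnion hd]
  exact isClosed_iUnion_of_finite fun i => isClosed_Yij_succ hpos i

theorem genericOrbit_nonempty (hd : IsConcave d) : (genericOrbit K d).Nonempty :=
  ⟨fun _ => diagOne K _ _, (mem_genericOrbit_iff hd).2 fun _ => rank_diagOne _ _⟩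

theorem components_Y [Infinite K] (hd : IsConcave d) (hpos : ∀ i, 0 < d i) :
    components (Y K d) =
      Set.range fun i : Fin n => Yij K d i.castSucc i.succ i.castSucc_lt_succ :=
  components_eq_range (Y_eq_iUnion hd) (isIrreducible_Yij_succ hpos) (isClosed_Yij_succ hpos)
    (Yij_succ_injective hpos)

/-- An irreducible `Y_{i,j}` would lie in one of the finitely many closed loci `Y_{l,l+1}` covering
it. If `j > i + 1`, some other map between `i` and `j` is zero in `Rep.single K d l`, which
therefore lies in `Y_{i,j}` but not in `Y_{l,l+1}`. -/
theorem isIrreducible_Yij_iff [Infinite K] (hd : IsConcave d) (hpos : ∀ i, 0 < d i)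
    (i j : Fin (n + 1)) (h : i < j) :
    IsIrreducible (Yij K d i j h) ↔ (j : ℕ) = (i : ℕ) + 1 := by
  constructor
  · intro hirr
    by_contra hj
    classical
    have hsub : Yij K d i j h ⊆ ⋃ l ∈ {l : Fin n | (i : ℕ) ≤ l ∧ (l : ℕ) < j},
        Yij K d l.castSucc l.succ l.castSucc_lt_succ :=
      fun A hA => Yij_subset_iUnion hd i j h (ne_of_lt hA)
    obtain ⟨_, hZ, hZi⟩ := isIrreducible_iff_sUnion_isClosed.1 hirr
      ((Finset.univ.filter fun l : Fin n => (i : ℕ) ≤ l ∧ (l : ℕ) < j).image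
        fun l : Fin n => Yij K d l.castSucc l.succ l.castSucc_lt_succ)
      (by
        simp only [Finset.mem_image]
        rintro _ ⟨l, -, rfl⟩
        exact isClosed_Yij_succ hpos l)
      (by simpa [Set.sUnion_image] using hsub)
    obtain ⟨l, hl, rfl⟩ := Finset.mem_image.1 hZ
    have hl := (Finset.mem_filter.1 hl).2
    refine Rep.single_notMem_Yij l (hZi ?_)
    change Rep.rk _ i j h.le < minDim d i j h.le
    have h' := Fin.lt_def.1 h
    have hzero : (Rep.single K d l).rk i j h.le = 0 := by
      obtain ⟨m, hm⟩ := Nat.exists_eq_add_of_le (Fin.le_def.1 h.le)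
      have hn := j.2
      obtain ⟨x, hx, hx₁, hx₂⟩ : ∃ x : Fin n, x ≠ l ∧ (i : ℕ) ≤ x ∧ (x : ℕ) < i + m := by
        by_cases hli : (l : ℕ) = i
        · exact ⟨⟨i + 1, by omega⟩, fun h => by simp [Fin.ext_iff] at h; omega,
            by simp, by simp only; omega⟩
        · exact ⟨⟨i, by omega⟩, fun h => by simp [Fin.ext_iff] at h; omega,
            by simp, by simp only; omega⟩
      rw [Rep.rk_eq_rank_comp _ i m (by omega) j h.le hm,
        Rep.comp_eq_zero _ (l := x) (by simp [Rep.single, hx]) i m _ hx₁ hx₂, Matrix.rank_zero]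
    rw [hzero]
    exact Nat.lt_of_lt_of_le Nat.zero_lt_one (le_minDim _ fun x _ _ => hpos x)
  · intro hj
    have hn : (i : ℕ) < n := by omega
    obtain ⟨l, rfl⟩ : ∃ l : Fin n, l.castSucc = i := ⟨⟨i, hn⟩, rfl⟩
    obtain rfl : j = l.succ := Fin.ext hj
    exact isIrreducible_Yij_succ hpos _

end Components

end TypeA
namespace TypeA

/-! ### Adapting bases to injective and surjective maps -/

section LinearAlgebra

theorem exists_equiv_sum_extending {ι E ι' : Type*} [Finite ι'] [Finite (ι ⊕ E)] {g : ι → ι'}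
    (hg : Function.Injective g) (hc : Nat.card (ι ⊕ E) = Nat.card ι') :
    ∃ e : ι ⊕ E ≃ ι', ∀ p, e (.inl p) = g p := by
  classical
  have : Finite ι := Finite.of_injective _ hg
  have : Finite E := Finite.of_injective (Sum.inr : E → ι ⊕ E) Sum.inr_injective
  have hE : Nat.card E = Nat.card ((Set.range g)ᶜ : Set ι') := by
    have h₁ := Nat.card_congr ((Equiv.sumCongr (Equiv.ofInjective g hg)
      (Equiv.refl ((Set.range g)ᶜ : Set ι'))).trans (Equiv.Set.sumCompl (Set.range g)))
    rw [Nat.card_sum] at h₁ hc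
    omega
  refine ⟨(Equiv.sumCongr (Equiv.ofInjective g hg) (Finite.card_eq.1 hE).some).trans
    (Equiv.Set.sumCompl (Set.range g)), fun p => ?_⟩
  simp

variable {K V W ι ι' : Type*} [Field K] [AddCommGroup V] [Module K V] [AddCommGroup W] [Module K W]
  [FiniteDimensional K W] [Finite ι']

theorem exists_basis_of_injective {f : V →ₗ[K] W} (hf : Function.Injective f)
    (b : Module.Basis ι K V) {g : ι → ι'} (hg : Function.Injective g)
    (hc : Module.finrank K W = Nat.card ι') :
    ∃ b' : Module.Basis ι' K W, ∀ p, b' (g p) = f (b p) := by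
  have hli : LinearIndependent K (f ∘ b) :=
    b.linearIndependent.map' f (LinearMap.ker_eq_bot.2 hf)
  let B := Module.Basis.sumExtend hli
  have : Finite (ι ⊕ Module.Basis.sumExtendIndex hli) := Module.Finite.finite_basis B
  obtain ⟨e, he⟩ := exists_equiv_sum_extending (E := Module.Basis.sumExtendIndex hli) hg
    ((Module.finrank_eq_nat_card_basis B).symm.trans hc)
  refine ⟨B.reindex e, fun p => ?_⟩
  rw [← he, Module.Basis.reindex_apply, Equiv.symm_apply_apply]
  simp [B, Module.Basis.sumExtend]
  rfl

theorem exists_basis_of_surjective {f : W →ₗ[K] V} (hf : Function.Surjective f)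
    (b : Module.Basis ι K V) {g : ι → ι'} (hg : Function.Injective g)
    (hc : Module.finrank K W = Nat.card ι') :
    ∃ b' : Module.Basis ι' K W, (∀ p, f (b' (g p)) = b p) ∧ ∀ q ∉ Set.range g, f (b' q) = 0 := by
  obtain ⟨s, hs⟩ := f.exists_rightInverse_of_surjective (LinearMap.range_eq_top.2 hf)
  have hs' : ∀ x, f (s x) = x := fun x => LinearMap.congr_fun hs x
  -- A section `s` splits `W` as `V × ker f`; the new basis joins the lifts of `b` to a basis of the
  -- kernel.
  let φ : (V × f.ker) ≃ₗ[K] W := LinearEquiv.ofBijective (s.coprod f.ker.subtype) (by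
    constructor
    · rw [injective_iff_map_eq_zero]
      rintro ⟨x, y, hy⟩ h
      simp only [LinearMap.coprod_apply, Submodule.subtype_apply] at h
      have hx : x = 0 := by
        have := congrArg f h
        rwa [map_add, hs', LinearMap.mem_ker.1 hy, add_zero, map_zero] at this
      subst hx
      simp only [map_zero, zero_add] at h
      subst h
      rfl
    · intro w
      exact ⟨(f w, ⟨w - s (f w), by simp [hs']⟩), by simp⟩)
  have hφ : ∀ x y, φ (x, y) = s x + y := fun _ _ => rfl
  let c := Module.finBasis K f.ker
  let B := (b.prod c).map φ
  have := Module.Finite.finite_basis B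
  obtain ⟨e, he⟩ := exists_equiv_sum_extending hg ((Module.finrank_eq_nat_card_basis B).symm.trans hc)
  refine ⟨B.reindex e, fun p => ?_, fun q hq => ?_⟩
  · rw [← he, Module.Basis.reindex_apply, Equiv.symm_apply_apply]
    simp [B, hφ, hs']
  · obtain ⟨x | y, rfl⟩ := e.surjective q
    · exact absurd ⟨x, (he x).symm⟩ hq
    · rw [Module.Basis.reindex_apply, Equiv.symm_apply_apply]
      simp [B, hφ]

end LinearAlgebra

/-- Choosing elements along a chain, starting at `a` and moving away from it. -/
theorem exists_chain {n : ℕ} (a : Fin (n + 1)) (β : Fin (n + 1) → Sort*)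
    (C : ∀ i : Fin n, β i.castSucc → β i.succ → Prop) (h0 : Nonempty (β a))
    (hl : ∀ i : Fin n, i.castSucc < a → ∀ y, ∃ x, C i x y)
    (hr : ∀ i : Fin n, a ≤ i.castSucc → ∀ x, ∃ y, C i x y) :
    ∃ b : ∀ l, β l, ∀ i, C i (b i.castSucc) (b i.succ) := by
  induction n with
  | zero =>
    obtain ⟨x⟩ := h0
    exact ⟨fun l => (show a = l from Fin.ext (by omega)) ▸ x, fun i => i.elim0⟩
  | succ n ih =>
    rcases Fin.eq_zero_or_eq_succ a with rfl | ⟨a, rfl⟩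
    · obtain ⟨x⟩ := h0
      choose g hg using fun i => hr i (Fin.zero_le _)
      exact ⟨fun l => Fin.induction x g l, fun i => hg i _⟩
    · obtain ⟨b, hb⟩ := ih a (fun l => β l.succ) (fun i => C i.succ) h0
        (fun i hi => hl i.succ (Fin.succ_lt_succ_iff.2 hi))
        (fun i hi => hr i.succ (Fin.succ_le_succ_iff.2 hi))
      obtain ⟨x, hx⟩ := hl 0 (Fin.succ_pos a) (b 0)
      refine ⟨Fin.cons (α := β) x b, fun i => ?_⟩
      rcases Fin.eq_zero_or_eq_succ i with rfl | ⟨i, rfl⟩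
      · exact hx
      · exact hb i

/-! ### Multisegments whose segments extend outward from `a` -/

section Segments

variable {n : ℕ} {d : Fin (n + 1) → ℕ} {a : Fin (n + 1)}

/-- The segments `[1,i]` for `i < a`, the segments `[i+1,t]` for `i ≥ a`, and `[1,t]`. -/
def seg (a : Fin (n + 1)) : Option (Fin n) → NonemptyInterval (Fin (n + 1))
  | none => ⟨(0, Fin.last n), Fin.zero_le _⟩
  | some i => if i.castSucc < a then ⟨(0, i.castSucc), Fin.zero_le _⟩
    else ⟨(i.succ, Fin.last n), Fin.le_last _⟩

/-- The multiplicities of these segments in `M(d)`. -/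
def segMult (d : Fin (n + 1) → ℕ) (a : Fin (n + 1)) : Option (Fin n) → ℕ
  | none => d a
  | some i => (d i.castSucc - d i.succ) + (d i.succ - d i.castSucc)

/-- A set of vertices that, with each vertex, contains the ones on the other side of `a`. -/
def OutwardClosed (a : Fin (n + 1)) (s : NonemptyInterval (Fin (n + 1))) : Prop :=
  ∀ i : Fin n, (i.castSucc < a → i.succ ∈ s → i.castSucc ∈ s) ∧
    (a ≤ i.castSucc → i.castSucc ∈ s → i.succ ∈ s)

theorem mem_seg_none (l : Fin (n + 1)) : l ∈ seg a none :=
  ⟨Fin.zero_le _, Fin.le_last _⟩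

theorem mem_seg_some_of_lt {i : Fin n} (hi : i.castSucc < a) {l : Fin (n + 1)} :
    l ∈ seg a (some i) ↔ l ≤ i.castSucc := by
  simp [seg, hi, NonemptyInterval.mem_def]

theorem mem_seg_some_of_le {i : Fin n} (hi : a ≤ i.castSucc) {l : Fin (n + 1)} :
    l ∈ seg a (some i) ↔ i.succ ≤ l := by
  simp [seg, hi.not_gt, NonemptyInterval.mem_def, Fin.le_last]

theorem OutwardClosed.seg (a : Fin (n + 1)) (o : Option (Fin n)) : OutwardClosed a (seg a o) := by
  intro j
  cases o with
  | none => exact ⟨fun _ _ => mem_seg_none _, fun _ _ => mem_seg_none _⟩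
  | some i =>
    rcases lt_or_ge i.castSucc a with hi | hi
    · simp only [mem_seg_some_of_lt hi]
      refine ⟨fun _ h => j.castSucc_lt_succ.le.trans h, fun h h' => ?_⟩
      exact absurd (h.trans h') hi.not_ge
    · simp only [mem_seg_some_of_le hi]
      refine ⟨fun h h' => ?_, fun _ h => h.trans j.castSucc_lt_succ.le⟩
      exact absurd (hi.trans (Fin.castSucc_le_castSucc_iff.2 (Fin.succ_le_succ_iff.1 h'))) h.not_ge

theorem OutwardClosed.fst_eq {s : NonemptyInterval (Fin (n + 1))} (hs : OutwardClosed a s)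
    (h : s.fst ≤ a) : s.fst = 0 := by
  rcases Fin.eq_zero_or_eq_succ s.fst with h0 | ⟨i, hi⟩
  · exact h0
  · have := (hs i).1 (lt_of_lt_of_le i.castSucc_lt_succ (hi ▸ h)) (hi ▸ ⟨le_rfl, s.fst_le_snd⟩)
    exact absurd (hi.symm.le.trans this.1) i.castSucc_lt_succ.not_ge

theorem OutwardClosed.snd_eq {s : NonemptyInterval (Fin (n + 1))} (hs : OutwardClosed a s)
    (h : a ≤ s.snd) : s.snd = Fin.last n := by
  rcases Fin.eq_castSucc_or_eq_last s.snd with ⟨i, hi⟩ | h0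
  · have := (hs i).2 (hi ▸ h) (hi ▸ ⟨s.fst_le_snd, le_rfl⟩)
    exact absurd (this.2.trans hi.le) i.castSucc_lt_succ.not_ge
  · exact h0

theorem OutwardClosed.eq_seg_none {s : NonemptyInterval (Fin (n + 1))} (hs : OutwardClosed a s)
    (h : a ∈ s) : s = TypeA.seg a none :=
  NonemptyInterval.ext (Prod.ext (hs.fst_eq h.1) (hs.snd_eq h.2))

theorem OutwardClosed.eq_seg_of_lt {s : NonemptyInterval (Fin (n + 1))} (hs : OutwardClosed a s)
    {i : Fin n} (hi : i.castSucc < a) (h : i.castSucc = s.snd) : s = TypeA.seg a (some i) := by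
  have h0 := hs.fst_eq ((s.fst_le_snd.trans h.symm.le).trans hi.le)
  refine NonemptyInterval.ext (Prod.ext ?_ ?_)
  · simp [TypeA.seg, hi, h0]
  · simp [TypeA.seg, hi, ← h]

theorem OutwardClosed.eq_seg_of_le {s : NonemptyInterval (Fin (n + 1))} (hs : OutwardClosed a s)
    {i : Fin n} (hi : a ≤ i.castSucc) (h : i.succ = s.fst) : s = TypeA.seg a (some i) := by
  have h0 := hs.snd_eq ((hi.trans i.castSucc_lt_succ.le).trans (h.le.trans s.fst_le_snd))
  refine NonemptyInterval.ext (Prod.ext ?_ ?_)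
  · simp [TypeA.seg, hi.not_gt, h]
  · simp [TypeA.seg, hi.not_gt, h0]

theorem OutwardClosed.mem_range_seg {s : NonemptyInterval (Fin (n + 1))} (hs : OutwardClosed a s) :
    s ∈ Set.range (TypeA.seg a) := by
  rcases le_or_gt s.fst a with h₁ | h₁
  · rcases le_or_gt a s.snd with h₂ | h₂
    · exact ⟨none, (hs.eq_seg_none ⟨h₁, h₂⟩).symm⟩
    · rcases Fin.eq_castSucc_or_eq_last s.snd with ⟨i, hi⟩ | h0
      · exact ⟨some i, (hs.eq_seg_of_lt (hi ▸ h₂) hi.symm).symm⟩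
      · exact absurd (h0 ▸ Fin.le_last a) h₂.not_ge
  · rcases Fin.eq_zero_or_eq_succ s.fst with h0 | ⟨i, hi⟩
    · exact absurd (h0 ▸ Fin.zero_le a) h₁.not_ge
    · exact ⟨some i, (hs.eq_seg_of_le (Fin.le_castSucc_iff.2 (hi ▸ h₁)) hi.symm).symm⟩

theorem seg_injective (a : Fin (n + 1)) : Function.Injective (seg a) := by
  intro o o' h
  have h₁ : (seg a o).fst = (seg a o').fst := by rw [h]
  have h₂ : (seg a o).snd = (seg a o').snd := by rw [h]
  rcases o with _ | i <;> rcases o' with _ | j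
  · rfl
  · by_cases hj : j.castSucc < a
    · simp [seg, hj, Fin.ext_iff] at h₂
      omega
    · simp [seg, hj, Fin.ext_iff] at h₁
  · by_cases hi : i.castSucc < a
    · simp [seg, hi, Fin.ext_iff] at h₂
      omega
    · simp [seg, hi, Fin.ext_iff] at h₁
  · by_cases hi : i.castSucc < a <;> by_cases hj : j.castSucc < a
    · simpa [seg, hi, hj] using h₂
    · simp [seg, hi, hj, Fin.ext_iff] at h₁
    · simp [seg, hi, hj, Fin.ext_iff] at h₁
    · simpa [seg, hi, hj] using h₁

open Classical in
theorem Multisegment.card_idx (M : Multisegment n) (l : Fin (n + 1)) :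
    Nat.card (M.Idx l) = ∑ s, if l ∈ s then M s else 0 := by
  rw [Nat.card_congr (Equiv.subtypeSigmaEquiv (fun s => Fin (M s)) (fun s => l ∈ s)),
    Nat.card_eq_fintype_card, Fintype.card_sigma, ← Finset.sum_filter]
  simp only [Fintype.card_fin]
  exact (Finset.sum_subtype _ (by simp) M).symm

variable {M : Multisegment n}

theorem card_idx_base (hM : ∀ s, M s ≠ 0 → OutwardClosed a s) :
    Nat.card (M.Idx a) = M (seg a none) := by
  classical
  rw [M.card_idx, Finset.sum_eq_single (seg a none) (fun s _ hs => ?_) (by simp),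
    if_pos (mem_seg_none a)]
  rw [ite_eq_right_iff]
  intro ha
  by_contra hMs
  exact hs ((hM s hMs).eq_seg_none ha)

/-- One step away from `a` no segment is lost, and the only one gained is the one ending at the new
vertex. -/
theorem card_idx_castSucc (hM : ∀ s, M s ≠ 0 → OutwardClosed a s) {i : Fin n}
    (hi : i.castSucc < a) :
    Nat.card (M.Idx i.castSucc) = Nat.card (M.Idx i.succ) + M (seg a (some i)) := by
  classical
  have h : M (seg a (some i)) = ∑ s, if s = seg a (some i) then M s else 0 := by simp
  rw [M.card_idx, M.card_idx, h, ← Finset.sum_add_distrib]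
  refine Finset.sum_congr rfl fun s _ => ?_
  by_cases hMs : M s = 0
  · simp [hMs]
  have hs := hM s hMs
  by_cases h₁ : i.succ ∈ s
  · rw [if_pos ((hs i).1 hi h₁), if_pos h₁, if_neg, add_zero]
    rintro rfl
    exact absurd ((mem_seg_some_of_lt hi).1 h₁) i.castSucc_lt_succ.not_ge
  · rw [if_neg h₁, zero_add]
    congr 1
    refine propext ⟨fun h₂ => hs.eq_seg_of_lt hi (le_antisymm h₂.2 ?_), ?_⟩
    · by_contra! h₃
      exact h₁ ⟨h₂.1.trans i.castSucc_lt_succ.le, Fin.castSucc_lt_iff_succ_le.1 h₃⟩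
    · rintro rfl
      exact (mem_seg_some_of_lt hi).2 le_rfl

theorem card_idx_succ (hM : ∀ s, M s ≠ 0 → OutwardClosed a s) {i : Fin n}
    (hi : a ≤ i.castSucc) :
    Nat.card (M.Idx i.succ) = Nat.card (M.Idx i.castSucc) + M (seg a (some i)) := by
  classical
  have h : M (seg a (some i)) = ∑ s, if s = seg a (some i) then M s else 0 := by simp
  rw [M.card_idx, M.card_idx, h, ← Finset.sum_add_distrib]
  refine Finset.sum_congr rfl fun s _ => ?_
  by_cases hMs : M s = 0
  · simp [hMs]
  have hs := hM s hMs
  by_cases h₁ : i.castSucc ∈ s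
  · rw [if_pos ((hs i).2 hi h₁), if_pos h₁, if_neg, add_zero]
    rintro rfl
    exact absurd ((mem_seg_some_of_le hi).1 h₁) i.castSucc_lt_succ.not_ge
  · rw [if_neg h₁, zero_add]
    congr 1
    refine propext ⟨fun h₂ => hs.eq_seg_of_le hi (le_antisymm ?_ h₂.1), ?_⟩
    · by_contra! h₃
      exact h₁ ⟨Fin.le_castSucc_iff.2 h₃, i.castSucc_lt_succ.le.trans h₂.2⟩
    · rintro rfl
      exact (mem_seg_some_of_le hi).2 le_rfl

/-- The multiplicities of a multisegment with outward closed segments are determined by its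
dimension vector. -/
theorem card_idx_eq_iff (ha : AntitoneOn d (Set.Iic a)) (hb : MonotoneOn d (Set.Ici a))
    (hM : ∀ s, M s ≠ 0 → OutwardClosed a s) :
    (∀ l, Nat.card (M.Idx l) = d l) ↔ ∀ o, M (seg a o) = segMult d a o := by
  have hl : ∀ i : Fin n, i.castSucc < a → d i.succ ≤ d i.castSucc := fun i hi =>
    ha hi.le (Fin.castSucc_lt_iff_succ_le.1 hi) i.castSucc_lt_succ.le
  have hr : ∀ i : Fin n, a ≤ i.castSucc → d i.castSucc ≤ d i.succ := fun i hi =>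
    hb hi (hi.trans i.castSucc_lt_succ.le) i.castSucc_lt_succ.le
  constructor
  · intro h o
    cases o with
    | none => rw [← card_idx_base hM, h, segMult]
    | some i =>
      have h₁ := h i.castSucc
      have h₂ := h i.succ
      rw [segMult]
      rcases lt_or_ge i.castSucc a with hi | hi
      · have := card_idx_castSucc hM hi
        have := hl i hi
        omega
      · have := card_idx_succ hM hi
        have := hr i hi
        omega
  · intro h
    -- With propositions as fibres, `exists_chain` is induction outward from `a`.
    refine (exists_chain a (fun l => Nat.card (M.Idx l) = d l) (fun _ _ _ => True)
      ⟨(card_idx_base hM).trans (h none)⟩ (fun i hi hy => ⟨?_, trivial⟩)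
      fun i hi hx => ⟨?_, trivial⟩).1
    · have := card_idx_castSucc hM hi
      have := hl i hi
      rw [h, segMult] at *
      omega
    · have := card_idx_succ hM hi
      have := hr i hi
      rw [h, segMult] at *
      omega

theorem support_eq_image (hM : ∀ s, M s ≠ 0 → OutwardClosed a s)
    (h : ∀ o, M (seg a o) = segMult d a o) :
    {s | M s ≠ 0} = seg a '' {o | segMult d a o ≠ 0} := by
  ext s
  constructor
  · intro hs
    obtain ⟨o, rfl⟩ := (hM s hs).mem_range_seg
    exact ⟨o, (h o).symm.trans_ne hs, rfl⟩
  · rintro ⟨o, ho, rfl⟩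
    exact (h o).trans_ne ho

theorem ncard_support_eq_iff (hpos : ∀ i, 0 < d i) (hM : ∀ s, M s ≠ 0 → OutwardClosed a s)
    (h : ∀ o, M (seg a o) = segMult d a o) :
    {s | M s ≠ 0}.ncard = n + 1 ↔ ∀ i : Fin n, d i.castSucc ≠ d i.succ := by
  rw [support_eq_image hM h, Set.ncard_image_of_injective _ (seg_injective a)]
  have hcard : Nat.card (Option (Fin n)) = n + 1 := by simp
  rw [← hcard, ← Set.ncard_univ]
  have : {o | segMult d a o ≠ 0} = Set.univ ↔ ∀ i : Fin n, d i.castSucc ≠ d i.succ := by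
    rw [Set.eq_univ_iff_forall, Option.forall]
    simp only [Set.mem_ofPred_eq, segMult, (hpos a).ne', ne_eq, not_false_eq_true, true_and]
    -- The two truncated differences add up to `|d_i - d_{i+1}|`.
    exact forall_congr' fun i => by omega
  rw [← this]
  exact ⟨fun h => Set.eq_of_subset_of_ncard_le (Set.subset_univ _) h.ge, fun h => by rw [h]⟩

/-- The multisegment `M(d)`. -/
noncomputable def genericMultisegment (d : Fin (n + 1) → ℕ) (a : Fin (n + 1)) : Multisegment n :=
  Function.extend (seg a) (segMult d a) 0

theorem genericMultisegment_seg (o : Option (Fin n)) :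
    genericMultisegment d a (seg a o) = segMult d a o :=
  (seg_injective a).extend_apply _ _ _

theorem outwardClosed_of_genericMultisegment (s : NonemptyInterval (Fin (n + 1)))
    (hs : genericMultisegment d a s ≠ 0) : OutwardClosed a s := by
  by_cases h : ∃ o, seg a o = s
  · obtain ⟨o, rfl⟩ := h
    exact .seg a o
  · exact absurd (Function.extend_apply' _ _ _ h) hs

end Segments

/-! ### The generic multisegment and criteria for genericity -/

section Generic

variable {n : ℕ} {K : Type*} [Field K] {d : Fin (n + 1) → ℕ} {a : Fin (n + 1)}

theorem mulVec_injective_of_rank {m r : ℕ} {A : Matrix (Fin m) (Fin r) K} (h : A.rank = r) :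
    Function.Injective A.mulVecLin := by
  rw [← LinearMap.ker_eq_bot, ← Submodule.finrank_eq_zero (R := K)]
  have := A.mulVecLin.finrank_range_add_finrank_ker
  rw [Module.finrank_fin_fun] at this
  rw [Matrix.rank] at h
  omega

theorem mulVec_surjective_of_rank {m r : ℕ} {A : Matrix (Fin m) (Fin r) K} (h : A.rank = m) :
    Function.Surjective A.mulVecLin := by
  rw [← LinearMap.range_eq_top]
  refine Submodule.eq_top_of_finrank_eq ?_
  rw [Module.finrank_fin_fun]
  exact h

theorem injective_of_mem_genericOrbit (ha : AntitoneOn d (Set.Iic a))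
    (hb : MonotoneOn d (Set.Ici a)) {A : Rep K d} (hA : A ∈ genericOrbit K d) {i : Fin n}
    (hi : i.castSucc < a) : Function.Injective (A i).mulVecLin :=
  mulVec_injective_of_rank (((mem_genericOrbit_iff ⟨a, ha, hb⟩).1 hA i).trans
    (min_eq_right (ha hi.le (Fin.castSucc_lt_iff_succ_le.1 hi) i.castSucc_lt_succ.le)))

theorem surjective_of_mem_genericOrbit (ha : AntitoneOn d (Set.Iic a))
    (hb : MonotoneOn d (Set.Ici a)) {A : Rep K d} (hA : A ∈ genericOrbit K d) {i : Fin n}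
    (hi : a ≤ i.castSucc) : Function.Surjective (A i).mulVecLin :=
  mulVec_surjective_of_rank (((mem_genericOrbit_iff ⟨a, ha, hb⟩).1 hA i).trans
    (min_eq_left (hb hi (hi.trans i.castSucc_lt_succ.le) i.castSucc_lt_succ.le)))

theorem Rep.IsoTo.card_idx {A : Rep K d} {M : Multisegment n} (h : A.IsoTo M) (l : Fin (n + 1)) :
    Nat.card (M.Idx l) = d l := by
  obtain ⟨b, -⟩ := h
  rw [← Module.finrank_eq_nat_card_basis (b l), Module.finrank_fin_fun]

/-- Left of `a`, a segment missing the target vertex would give a basis vector killed by an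
injective map. Right of `a`, a segment starting at the target vertex would give a basis vector
outside the image of a surjective map. -/
theorem Rep.IsoTo.outwardClosed (ha : AntitoneOn d (Set.Iic a))
    (hb : MonotoneOn d (Set.Ici a)) {A : Rep K d} (hA : A ∈ genericOrbit K d)
    {M : Multisegment n} (h : A.IsoTo M) (s : NonemptyInterval (Fin (n + 1))) (hs : M s ≠ 0) :
    OutwardClosed a s := by
  classical
  obtain ⟨b, h⟩ := h
  let c : Fin (M s) := ⟨0, Nat.pos_of_ne_zero hs⟩
  refine fun i => ⟨fun hi his => ?_, fun hi his => ?_⟩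
  · by_contra hn
    have h₁ := h i ⟨⟨s, c⟩, his⟩
    rw [dif_neg hn, ← Matrix.mulVecLin_apply] at h₁
    exact (b i.succ).ne_zero _
      ((map_eq_zero_iff _ (injective_of_mem_genericOrbit ha hb hA hi)).1 h₁)
  · by_contra hn
    let q : M.Idx i.castSucc := ⟨⟨s, c⟩, his⟩
    -- Only a basis vector of the same copy could map onto that of `q`, and this copy misses
    -- `i.succ`; so the coordinate at `q` vanishes on the image.
    have hz : (b i.castSucc).coord q ∘ₗ (A i).mulVecLin = 0 := by
      refine (b i.succ).ext fun p => ?_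
      rw [LinearMap.comp_apply, Matrix.mulVecLin_apply, h i p]
      split_ifs with hp
      · rw [Module.Basis.coord_apply, Module.Basis.repr_self, LinearMap.zero_apply,
          Finsupp.single_apply, if_neg]
        intro hpq
        have hp' : p.1 = ⟨s, c⟩ := congrArg Subtype.val hpq
        exact hn (by simpa [hp'] using p.2)
      · simp
    obtain ⟨x, hx⟩ := surjective_of_mem_genericOrbit ha hb hA hi (b i.castSucc q)
    have := LinearMap.congr_fun hz x
    rw [LinearMap.comp_apply, hx] at this
    simp at this

theorem isoTo_genericMultisegment (ha : AntitoneOn d (Set.Iic a))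
    (hb : MonotoneOn d (Set.Ici a)) {A : Rep K d} (hA : A ∈ genericOrbit K d) :
    A.IsoTo (genericMultisegment d a) := by
  classical
  have hM := outwardClosed_of_genericMultisegment (d := d) (a := a)
  set M := genericMultisegment d a
  have hcard := (card_idx_eq_iff ha hb hM).2 fun o => genericMultisegment_seg o
  have hrank : ∀ l, Module.finrank K (Fin (d l) → K) = Nat.card (M.Idx l) := fun l => by
    rw [hcard, Module.finrank_fin_fun]
  have hclosed : ∀ {l : Fin (n + 1)} (p : M.Idx l), OutwardClosed a p.1.1 := fun p =>
    hM _ (fun h0 => (Fin.cast h0 p.1.2).elim0)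
  refine exists_chain a (fun l => Module.Basis (M.Idx l) K (Fin (d l) → K)) (fun i x y =>
    ∀ p : M.Idx i.succ, Matrix.mulVec (A i) (y p) =
        if h : i.castSucc ∈ p.1.1 then x ⟨p.1, h⟩ else 0) ?_ (fun i hi y => ?_) fun i hi x => ?_
  · have e : Fin (d a) ≃ M.Idx a := (Finite.card_eq.1 (by rw [hcard, Nat.card_fin])).some
    exact ⟨(Pi.basisFun K (Fin (d a))).reindex e⟩
  · obtain ⟨x, hx⟩ := exists_basis_of_injective (ι' := M.Idx i.castSucc)
      (injective_of_mem_genericOrbit ha hb hA hi) y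
      (g := fun p => ⟨p.1, (hclosed p i).1 hi p.2⟩)
      (fun p q hpq => Subtype.ext (Subtype.mk.inj hpq)) (hrank _)
    refine ⟨x, fun p => ?_⟩
    rw [dif_pos ((hclosed p i).1 hi p.2), hx p, Matrix.mulVecLin_apply]
  · obtain ⟨y, hy, hy'⟩ := exists_basis_of_surjective (ι' := M.Idx i.succ)
      (surjective_of_mem_genericOrbit ha hb hA hi) x
      (g := fun p => ⟨p.1, (hclosed p i).2 hi p.2⟩)
      (fun p q hpq => Subtype.ext (Subtype.mk.inj hpq)) (hrank _)
    refine ⟨y, fun p => ?_⟩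
    rw [← Matrix.mulVecLin_apply]
    split_ifs with hp
    · exact hy ⟨p.1, hp⟩
    · refine hy' p ?_
      rintro ⟨q, rfl⟩
      exact hp q.2

/-- The generic orbit is open and nonempty, so it meets every dense isomorphism class and determines
its multisegment. It is itself dense because the representation space is irreducible. -/
theorem isGeneric_iff_forall_ne [Infinite K] (hd : IsConcave d) (hpos : ∀ i, 0 < d i) :
    IsGeneric K d ↔ ∀ i : Fin n, d i.castSucc ≠ d i.succ := by
  obtain ⟨a, ha, hb⟩ := id hd
  have hopen := isOpen_genericOrbit (K := K) hd hpos
  have hne := genericOrbit_nonempty (K := K) hd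
  constructor
  · rintro ⟨M, hdense, hcard⟩
    obtain ⟨A, hA, hAM⟩ := hdense.inter_open_nonempty _ hopen hne
    have hM := hAM.outwardClosed ha hb hA
    exact (ncard_support_eq_iff hpos hM ((card_idx_eq_iff ha hb hM).1 hAM.card_idx)).1 hcard
  · intro h
    refine ⟨genericMultisegment d a, (hopen.dense hne).mono fun A hA =>
      isoTo_genericMultisegment ha hb hA, ?_⟩
    exact (ncard_support_eq_iff hpos outwardClosed_of_genericMultisegment
      genericMultisegment_seg).2 h

/-- If neighbours differ, `d` is strictly monotone on each side of `a`, so equal entries lie on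
opposite sides and `l = a` works. Conversely, nothing lies between neighbours. -/
theorem forall_ne_iff (hd : IsConcave d) :
    (∀ i : Fin n, d i.castSucc ≠ d i.succ) ↔
      ∀ i j : Fin (n + 1), i < j → d i = d j → ∃ l, i < l ∧ l < j ∧ d l < d i := by
  obtain ⟨a, ha, hb⟩ := hd
  constructor
  · intro h i j hij hd
    have hdec : ∀ x y : Fin (n + 1), x < y → y ≤ a → d y < d x := by
      intro x y hxy hya
      obtain ⟨l, rfl⟩ := Fin.exists_succ_eq.2 (Fin.ne_zero_of_lt hxy)
      have hxl : x ≤ l.castSucc := Fin.le_castSucc_iff.2 hxy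
      have hla : l.castSucc ≤ a := l.castSucc_lt_succ.le.trans hya
      exact lt_of_lt_of_le (lt_of_le_of_ne (ha hla hya l.castSucc_lt_succ.le) (h l).symm)
        (ha (hxl.trans hla) hla hxl)
    have hinc : ∀ x y : Fin (n + 1), x < y → a ≤ x → d x < d y := by
      intro x y hxy hax
      obtain ⟨l, rfl⟩ := Fin.exists_castSucc_eq.2 (ne_of_lt (hxy.trans_le (Fin.le_last y)))
      have hly : l.succ ≤ y := Fin.castSucc_lt_iff_succ_le.1 hxy
      have hal : a ≤ l.succ := hax.trans l.castSucc_lt_succ.le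
      exact lt_of_lt_of_le (lt_of_le_of_ne (hb hax hal l.castSucc_lt_succ.le) (h l))
        (hb hal (hal.trans hly) hly)
    have hja : a < j := by
      by_contra! hja
      exact absurd hd (hdec i j hij hja).ne'
    have hia : i < a := by
      by_contra! hia
      exact absurd hd (hinc i j hij hia).ne
    exact ⟨a, hia, hja, hdec i a hia le_rfl⟩
  · intro h i hi
    obtain ⟨l, h₁, h₂, -⟩ := h _ _ i.castSucc_lt_succ hi
    exact absurd (Fin.castSucc_lt_iff_succ_le.1 h₁) h₂.not_ge

end Generic

end TypeA

theorem mainTheorem10 {n : ℕ} (d : Fin (n + 1) → ℕ) (hconc : TypeA.IsConcave d)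
    (hpos : ∀ i, 0 < d i) (k : Type*) [Field k] (K : Type*) [Field K] [Algebra k K]
    [IsAlgClosure k K] :
    -- a)
    (TypeA.I d = Set.range (fun i : Fin n => (i.castSucc, i.succ)) ∧
      TypeA.J d = Set.range (fun i : Fin n => (i.castSucc, i.succ))) ∧
    -- b)
    ((TypeA.components (TypeA.Y K d)).ncard = n ∧
      Set.BijOn (fun i : Fin n => TypeA.Yij K d i.castSucc i.succ i.castSucc_lt_succ)
        Set.univ (TypeA.components (TypeA.Y K d)) ∧
      ∀ i : Fin n, TypeA.codim (TypeA.Yij K d i.castSucc i.succ i.castSucc_lt_succ) =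
        ((((d i.castSucc : ℤ) - (d i.succ : ℤ)).natAbs + 1 : ℕ) : ℕ∞)) ∧
    -- c)
    (∀ (i j : Fin (n + 1)) (h : i < j),
      IsIrreducible (TypeA.Yij K d i j h) ↔ (j : ℕ) = (i : ℕ) + 1) ∧
    -- d)
    (TypeA.IsGeneric K d ↔
      ∀ i j : Fin (n + 1), i < j → d i = d j → ∃ l, i < l ∧ l < j ∧ d l < d i) ∧
    -- e)
    Set.BijOn (fun i : Fin n => TypeA.Yij K d i.castSucc i.succ i.castSucc_lt_succ)
      {i | d i.castSucc = d i.succ}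
      {Z | Z ∈ TypeA.components (TypeA.Y K d) ∧ TypeA.codim Z = 1} := by
  have : IsAlgClosed K := IsAlgClosure.isAlgClosed k
  have hinj : Function.Injective
      fun i : Fin n => TypeA.Yij K d i.castSucc i.succ i.castSucc_lt_succ :=
    fun i j h => TypeA.Yij_succ_injective hpos i j (le_of_eq h)
  have hcomp := TypeA.components_Y (K := K) hconc hpos
  have hcodim := TypeA.codim_Yij_succ (K := K) hpos
  refine ⟨⟨(TypeA.I_eq_J hconc hpos).trans (TypeA.J_eq_range hconc), TypeA.J_eq_range hconc⟩,
    ⟨?_, ?_, hcodim⟩, TypeA.isIrreducible_Yij_iff hconc hpos,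
    (TypeA.isGeneric_iff_forall_ne hconc hpos).trans (TypeA.forall_ne_iff hconc), ?_⟩
  · rw [hcomp, ← Set.image_univ, Set.ncard_image_of_injective _ hinj, Set.ncard_univ, Nat.card_fin]
  · rw [hcomp, ← Set.image_univ]
    exact hinj.injOn.bijOn_image
  · have hone : ∀ i : Fin n, TypeA.codim (TypeA.Yij K d i.castSucc i.succ i.castSucc_lt_succ) = 1 ↔
        d i.castSucc = d i.succ := fun i => by
      rw [hcodim, Nat.cast_eq_one]
      omega
    refine ⟨fun i hi => ⟨hcomp ▸ ⟨i, rfl⟩, (hone i).2 hi⟩, hinj.injOn, ?_⟩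
    rintro Z ⟨hZ, hc⟩
    rw [hcomp] at hZ
    obtain ⟨i, rfl⟩ := hZ
    exact ⟨i, (hone i).1 hc, rfl⟩
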